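/- Let $1\le d\le 6$ and $\alpha\ge 0$. Let $f:\mathbb R\to\mathbb R$ be an odd $C^1$ function with $f'(0)=0$, put $F(y)=\int_0^y f(s)\,ds$, and assume: (i) there is $\gamma>0$ such that $\int_{\mathbb R^d}\big(2(1+\gamma)F(\varphi)-\varphi f(\varphi)\big)\,dx\le 0$ for all $\varphi\in H^1(\mathbb R^d)$; (ii) if $d\ge 2$, there are constants $C$, $1<\theta<\theta^*$ and $0<\beta<\theta-1$ such that $|f'(y)|\le C\max(|y|^{\beta},|y|^{\theta-1})$ for all $y\in\mathbb R$, where $\theta^*=\frac{d+2}{d-2}$ if $d\ge 3$ and $\theta^*=\infty$ if $d=2$. Let $\vec u_0=(\varphi_0,\varphi_1)\in H^1(\mathbb R^d)\times L^2(\mathbb R^d)$ (real-valued, radial or not), and let $u$ be the solution of $$\partial_t^2u+2\alpha\,\partial_tu-\Delta u+u-f(u)=0,\qquad (u(0),\partial_tu(0))=(\varphi_0,\varphi_1),\tag{$(KG)_\alpha$}$$ on its maximal interval of existence $[0,T^*)$, $0<T^*\le\infty$. Here a solution on $[0,T)$ is a function $u\in C([0,T),H^1(\mathbb R^d))\cap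 C^1([0,T),L^2(\mathbb R^d))$ with $f(u)\in L^1_{\rm loc}([0,T),L^2(\mathbb R^d))$ which attains the initial data and satisfies the equation in $H^{-1}(\mathbb R^d)$, integrated in time; $[0,T^*)$ is maximal if $u$ does not extend to a solution on a longer interval. If the initial energy $$E(\vec u_0)=\int_{\mathbb R^d}\Big(\tfrac12|\nabla\varphi_0|^2+\tfrac12\varphi_0^2+\tfrac12\varphi_1^2-F(\varphi_0)\Big)\,dx$$ is negative, then $T^*<\infty$, i.e. the solution blows up in finite time. -/

import Mathlib

open MeasureTheory

noncomputable section

namespace KleinGordon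

/-- Euclidean space `ℝ^d`. -/
abbrev E (d : ℕ) : Type := EuclideanSpace ℝ (Fin d)

/-- The real Hilbert space `L²(ℝ^d)`. -/
abbrev L2 (d : ℕ) : Type := Lp ℝ 2 (volume : Measure (E d))

/-- The real Hilbert space `L²(ℝ^d; ℝ^d)` of square integrable vector fields. -/
abbrev L2Vec (d : ℕ) : Type := Lp (E d) 2 (volume : Measure (E d))

/-- `G` is the weak gradient of `φ`: for all test functions `η ∈ C_c^∞(ℝ^d)` and all directions `e`,
`∫ φ ∂_e η = - ∫ (G · e) η`. -/
def IsWeakGradient {d : ℕ} (φ : E d → ℝ) (G : E d → E d) : Prop :=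
  ∀ η : E d → ℝ, ContDiff ℝ ((⊤ : ℕ∞) : WithTop ℕ∞) η → HasCompactSupport η → ∀ e : E d,
    ∫ x, φ x * fderiv ℝ η x e = - ∫ x, inner ℝ (G x) e * η x

lemma integrable_mul_fderiv {d : ℕ} (φ : L2 d) {η : E d → ℝ}
    (hη : ContDiff ℝ ((⊤ : ℕ∞) : WithTop ℕ∞) η) (hc : HasCompactSupport η) (e : E d) :
    Integrable (fun x => φ x * fderiv ℝ η x e) := by
  have h1 : Continuous (fun x => fderiv ℝ η x e) :=
    (hη.continuous_fderiv (by simp)).clm_apply continuous_const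
  have h2 : HasCompactSupport (fun x => fderiv ℝ η x e) := hc.fderiv_apply (𝕜 := ℝ) e
  have h3 : MemLp (fun x => fderiv ℝ η x e) 2 (volume : Measure (E d)) :=
    h1.memLp_of_hasCompactSupport h2
  exact (Lp.memLp φ).integrable_mul h3

lemma integrable_inner_mul {d : ℕ} (G : L2Vec d) {η : E d → ℝ}
    (hη : ContDiff ℝ ((⊤ : ℕ∞) : WithTop ℕ∞) η) (hc : HasCompactSupport η) (e : E d) :
    Integrable (fun x => inner ℝ (G x) e * η x) := by
  have hG : MemLp (fun x => inner ℝ (G x) e) 2 (volume : Measure (E d)) :=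
    (Lp.memLp G).inner_const e
  have hL : MemLp η 2 (volume : Measure (E d)) := hη.continuous.memLp_of_hasCompactSupport hc
  exact hG.integrable_mul hL

/-- The Sobolev space `H¹(ℝ^d)`: the pairs `(φ, ∇φ)` of a function in `L²` with weak gradient in
`L²`, with the norm `‖φ‖_{H¹}² = ‖φ‖_{L²}² + ‖∇φ‖_{L²}²`. -/
def H1 (d : ℕ) : Submodule ℝ (WithLp 2 (L2 d × L2Vec d)) where
  carrier := {p | IsWeakGradient (p.fst : E d → ℝ) (p.snd : E d → E d)}
  zero_mem' := by
    intro η hη hc e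
    simp
  add_mem' := by
    intro p q hp hq η hη hc e
    have h1 : (fun x => ((p.fst + q.fst : L2 d) : E d → ℝ) x * fderiv ℝ η x e) =ᵐ[volume]
        fun x => p.fst x * fderiv ℝ η x e + q.fst x * fderiv ℝ η x e := by
      filter_upwards [Lp.coeFn_add p.fst q.fst] with x hx
      rw [hx, Pi.add_apply, add_mul]
    have h2 : (fun x => inner ℝ (((p.snd + q.snd : L2Vec d) : E d → E d) x) e * η x) =ᵐ[volume]
        fun x => inner ℝ (p.snd x) e * η x + inner ℝ (q.snd x) e * η x := by
      filter_upwards [Lp.coeFn_add p.snd q.snd] with x hx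
      rw [hx, Pi.add_apply, inner_add_left, add_mul]
    rw [WithLp.add_fst, WithLp.add_snd, integral_congr_ae h1, integral_congr_ae h2,
      integral_add (integrable_mul_fderiv _ hη hc e) (integrable_mul_fderiv _ hη hc e),
      integral_add (integrable_inner_mul _ hη hc e) (integrable_inner_mul _ hη hc e),
      hp η hη hc e, hq η hη hc e]
    ring
  smul_mem' := by
    intro c p hp η hη hc e
    have h1 : (fun x => ((c • p.fst : L2 d) : E d → ℝ) x * fderiv ℝ η x e) =ᵐ[volume]
        fun x => c * (p.fst x * fderiv ℝ η x e) := by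
      filter_upwards [Lp.coeFn_smul c p.fst] with x hx
      rw [hx, Pi.smul_apply, smul_eq_mul, mul_assoc]
    have h2 : (fun x => inner ℝ (((c • p.snd : L2Vec d) : E d → E d) x) e * η x) =ᵐ[volume]
        fun x => c * (inner ℝ (p.snd x) e * η x) := by
      filter_upwards [Lp.coeFn_smul c p.snd] with x hx
      rw [hx, Pi.smul_apply, real_inner_smul_left, mul_assoc]
    rw [WithLp.smul_fst, WithLp.smul_snd, integral_congr_ae h1, integral_congr_ae h2,
      integral_const_mul, integral_const_mul, hp η hη hc e]
    ring

/-- The `L²` function underlying an element of `H¹`. -/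
def fn {d : ℕ} (φ : H1 d) : L2 d := (φ : WithLp 2 (L2 d × L2Vec d)).fst

/-- The weak gradient of an element of `H¹`. -/
def grad {d : ℕ} (φ : H1 d) : L2Vec d := (φ : WithLp 2 (L2 d × L2Vec d)).snd

/-- The primitive `F(y) = ∫_0^y f(s) ds`. -/
def primitive (f : ℝ → ℝ) (y : ℝ) : ℝ := ∫ s in (0 : ℝ)..y, f s

/-- The Ambrosetti–Rabinowitz type condition: there is `γ > 0` with
`∫ (2 (1 + γ) F(φ) - φ f(φ)) dx ≤ 0` for all `φ ∈ H¹(ℝ^d)`. -/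
def AmbrosettiRabinowitz (d : ℕ) (f : ℝ → ℝ) : Prop :=
  ∃ γ : ℝ, 0 < γ ∧ ∀ φ : H1 d,
    ∫ x, (2 * (1 + γ) * primitive f (fn φ x) - fn φ x * f (fn φ x)) ≤ 0

/-- The energy-subcritical growth condition `|f'(y)| ≤ C max(|y|^β, |y|^(θ-1))` for some `C`,
`1 < θ < θ*` and `0 < β < θ - 1`, where `θ* = (d+2)/(d-2)` if `d ≥ 3`, and `θ* = ∞` otherwise. -/
def SubcriticalGrowth (d : ℕ) (f : ℝ → ℝ) : Prop :=
  ∃ C θ β : ℝ, 1 < θ ∧ (3 ≤ d → θ < ((d : ℝ) + 2) / ((d : ℝ) - 2)) ∧ 0 < β ∧ β < θ - 1 ∧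
    ∀ y : ℝ, |deriv f y| ≤ C * max (|y| ^ β) (|y| ^ (θ - 1))

/-- The energy
`E(φ, ψ) = ∫ (|∇φ|²/2 + φ²/2 + ψ²/2 - F(φ)) dx` of `(φ, ψ) ∈ H¹ × L²`. -/
def energy {d : ℕ} (f : ℝ → ℝ) (φ : H1 d) (ψ : L2 d) : ℝ :=
  ∫ x, (1 / 2 * ‖grad φ x‖ ^ 2 + 1 / 2 * (fn φ x) ^ 2 + 1 / 2 * (ψ x) ^ 2
    - primitive f (fn φ x))

/-- The times `0 ≤ t < T`, where `T` may be `+∞`. -/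
def timeInterval (T : EReal) : Set ℝ := {t | 0 ≤ t ∧ (t : EReal) < T}

/-- `(u, v) = (u, ∂_t u)` is a strong solution on `[0, T)`, `0 < T ≤ ∞`, of
`∂_t² u + 2α ∂_t u - Δu + u - f(u) = 0`, `(u(0), ∂_t u(0)) = (φ₀, φ₁)`:

* `u ∈ C([0,T), H¹) ∩ C¹([0,T), L²)` with time derivative `v`;
* `f(u) ∈ L¹_loc([0,T), L²)`, so that the Duhamel integral of `f(u)` makes sense in `H¹ × L²`;
* the equation holds in `H⁻¹(ℝ^d)`, that is, tested with any `w ∈ H¹(ℝ^d)`, and integrated in time. -/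
structure IsSolution {d : ℕ} (α : ℝ) (f : ℝ → ℝ) (φ₀ : H1 d) (φ₁ : L2 d) (T : EReal)
    (u : ℝ → H1 d) (v : ℝ → L2 d) : Prop where
  pos : 0 < T
  init_fst : u 0 = φ₀
  init_snd : v 0 = φ₁
  continuousOn_fst : ContinuousOn u (timeInterval T)
  continuousOn_snd : ContinuousOn v (timeInterval T)
  hasDeriv : ∀ t ∈ timeInterval T,
    HasDerivWithinAt (fun s => fn (u s)) (v t) (timeInterval T) t
  equation : ∃ g : ℝ → L2 d,
    (∀ᵐ s : ℝ, s ∈ timeInterval T → g s =ᵐ[volume] fun x => f (fn (u s) x)) ∧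
    ∀ t ∈ timeInterval T, IntervalIntegrable g volume 0 t ∧
      ∀ w : H1 d,
        inner ℝ (v t) (fn w) - inner ℝ φ₁ (fn w)
          + 2 * α * (inner ℝ (fn (u t)) (fn w) - inner ℝ (fn φ₀) (fn w))
          + (∫ s in (0 : ℝ)..t, (inner ℝ (grad (u s)) (grad w) + inner ℝ (fn (u s)) (fn w)
              - inner ℝ (g s) (fn w))) = 0

/-- `(u, v)` is a solution on `[0, T)` that has no extension to a solution on a longer interval;
`T` is then the maximal time of existence. -/
def IsMaximalSolution {d : ℕ} (α : ℝ) (f : ℝ → ℝ) (φ₀ : H1 d) (φ₁ : L2 d) (T : EReal)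
    (u : ℝ → H1 d) (v : ℝ → L2 d) : Prop :=
  IsSolution α f φ₀ φ₁ T u v ∧
    ∀ (T' : EReal) (u' : ℝ → H1 d) (v' : ℝ → L2 d), IsSolution α f φ₀ φ₁ T' u' v' →
      (∀ t ∈ timeInterval T, u' t = u t ∧ v' t = v t) → T' ≤ T

end KleinGordon

end

/-! Assume the solution is global and run Levine's concavity method. Write `y = ‖u‖²` in L² and `E₀
< 0` for the initial energy. The energy identity says that `∫ F(u(t))` equals `½‖u‖²_{H¹} + ½‖v‖² +
2α ∫₀ᵗ ‖v‖² - E₀`. The Ambrosetti–Rabinowitz inequality turns this into a lower bound for `⟪f(u),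
u⟫`, which enters the virial identity for `⟪v, u⟫`. For `G = y + 2α ∫₀ᵗ y + 2α y(0)(T - t) + β (t +
τ)²` with `β = -2E₀`, and `P = ‖v‖² + 2α ∫₀ᵗ ‖v‖² + β`, this yields an integrated form of `G'' ≥ 4(1
+ κ) P`, while Cauchy–Schwarz gives `G'² ≤ 4 G P`. Hence a negative power of `G` lies below a line
that reaches zero by time `T`, which is absurd (`concavity_contradiction`,
`IsWeakDampedWave.blowup`).

The analytic work lies in the two identities, since `v` takes values only in L² and is no admissible
test function. The equation is tested with time increments of `u` (for the energy) or with `u`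
itself (for the virial), averaged over windows of length `h`, and `h → 0`. As `f(u)` is only L¹ in
time, `tendsto_integral_average_inner` passes to the limit by density of continuous sources.

The remaining link, `∫ F(u(t)) - ∫ F(u(0)) = ∫₀ᵗ ⟪f(u), v⟫` (`integral_primitive_evolution`), is
proved by truncating `f` to Lipschitz functions. Domination comes from the sign of `f`: negative
energy makes `F` positive somewhere, and the pointwise inequality `2(1+γ) F(y) ≤ y f(y)` then keeps
`f` nonnegative to the right of that point. -/

noncomputable section

namespace KleinGordon

open Filter Topology Set
open scoped RealInnerProductSpace NNReal

/-! ### Window integrals and averages in time. -/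

section Averages

variable {B : Type*} [NormedAddCommGroup B] [NormedSpace ℝ B]

lemma continuous_integral_window {c : ℝ → B} (hc : ∀ a b, IntervalIntegrable c volume a b)
    (h : ℝ) : Continuous fun s : ℝ => ∫ r in s..s + h, c r := by
  have heq : (fun s : ℝ => ∫ r in s..s + h, c r) =
      fun s => (∫ r in (0 : ℝ)..s + h, c r) - ∫ r in (0 : ℝ)..s, c r := by
    funext s
    rw [intervalIntegral.integral_interval_sub_left (hc _ _) (hc _ _)]
  rw [heq]
  have h1 : Continuous fun s : ℝ => ∫ r in (0 : ℝ)..s, c r :=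
    intervalIntegral.continuous_primitive hc 0
  exact (h1.comp (continuous_add_const h)).sub h1

lemma tendsto_average [CompleteSpace B] {c : ℝ → B} (hc : Continuous c) (t : ℝ) :
    Tendsto (fun h : ℝ => h⁻¹ • ∫ s in t..t + h, c s) (𝓝[>] 0) (𝓝 (c t)) := by
  have h := (hc.integral_hasStrictDerivAt t t).hasDerivAt.tendsto_slope_zero_right
  simpa using h

/-- After a shift of variable the integral telescopes to the windows `[t, t + h]` and `[0, h]`. -/
lemma tendsto_integral_difference {c : ℝ → ℝ} (hc : Continuous c) (t : ℝ) :
    Tendsto (fun h : ℝ => h⁻¹ * ∫ s in (0 : ℝ)..t, (c (s + h) - c s)) (𝓝[>] 0)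
      (𝓝 (c t - c 0)) := by
  have h1 := (tendsto_average hc t).sub (tendsto_average hc 0)
  refine h1.congr fun h => ?_
  have hi : ∀ a b : ℝ, IntervalIntegrable c volume a b := fun a b => hc.intervalIntegrable a b
  have hs : IntervalIntegrable (fun s => c (s + h)) volume 0 t :=
    (hc.comp (continuous_add_const h)).intervalIntegrable _ _
  rw [intervalIntegral.integral_sub hs (hi _ _),
    intervalIntegral.integral_comp_add_right (fun x => c x) h]
  have h2 := intervalIntegral.integral_add_adjacent_intervals (hi 0 h) (hi h (t + h))
  have h3 := intervalIntegral.integral_add_adjacent_intervals (hi 0 t) (hi t (t + h))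
  simp only [smul_eq_mul, zero_add]
  rw [← mul_sub]
  congr 1
  linarith

/-- The same telescoping: the window at `0` is nonnegative and can be dropped. The factor `h`
cancels the `h⁻¹` of an average, so L¹-small sources have small averages uniformly in `h`. -/
lemma integral_increment_le {ρ : ℝ → ℝ} (hρ : Continuous ρ) (hm : MonotoneOn ρ (Ici 0))
    (hρ0 : ρ 0 = 0) {t h : ℝ} (ht : 0 ≤ t) (hh : 0 ≤ h) :
    ∫ s in (0 : ℝ)..t, (ρ (s + h) - ρ s) ≤ h * ρ (t + h) := by
  have hi : ∀ a b : ℝ, IntervalIntegrable ρ volume a b := fun a b => hρ.intervalIntegrable a b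
  have hs : IntervalIntegrable (fun s => ρ (s + h)) volume 0 t :=
    (hρ.comp (continuous_add_const h)).intervalIntegrable _ _
  rw [intervalIntegral.integral_sub hs (hi _ _),
    intervalIntegral.integral_comp_add_right (fun x => ρ x) h]
  have h2 := intervalIntegral.integral_add_adjacent_intervals (hi 0 h) (hi h (t + h))
  have h3 := intervalIntegral.integral_add_adjacent_intervals (hi 0 t) (hi t (t + h))
  have h4 : 0 ≤ ∫ s in (0 : ℝ)..h, ρ s := by
    refine intervalIntegral.integral_nonneg hh fun s hs => ?_
    rw [← hρ0]
    exact hm (by simp) hs.1 hs.1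
  have h5 : ∫ s in t..t + h, ρ s ≤ ∫ s in t..t + h, ρ (t + h) := by
    refine intervalIntegral.integral_mono_on (by linarith) (hi _ _) (by simp) fun s hs => ?_
    exact hm (mem_Ici.2 (ht.trans hs.1)) (mem_Ici.2 (by linarith)) hs.2
  rw [intervalIntegral.integral_const, smul_eq_mul] at h5
  simp only [zero_add]
  have : t + h - t = h := by ring
  rw [this] at h5
  linarith

end Averages

/-! ### Limits of averaged sources. -/

section SteklovSource

variable {H : Type*} [NormedAddCommGroup H] [InnerProductSpace ℝ H] [CompleteSpace H]

omit [CompleteSpace H] in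
lemma intervalIntegrable_inner {g p : ℝ → H} {a b : ℝ} (hg : IntervalIntegrable g volume a b)
    (hp : Continuous p) : IntervalIntegrable (fun s => ⟪g s, p s⟫) volume a b := by
  obtain ⟨M, hM⟩ := (isCompact_uIcc (a := a) (b := b)).exists_bound_of_continuousOn
    hp.continuousOn
  refine (hg.norm.mul_const M).mono_fun
    (hg.def'.aestronglyMeasurable.inner hp.aestronglyMeasurable) ?_
  refine (ae_restrict_iff' measurableSet_uIoc).2 (Eventually.of_forall fun s hs => ?_)
  have h := hM s (uIoc_subset_uIcc hs)
  simp only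
  rw [Real.norm_of_nonneg (mul_nonneg (norm_nonneg (g s)) ((norm_nonneg _).trans h))]
  exact (norm_inner_le_norm _ _).trans (mul_le_mul_of_nonneg_left h (norm_nonneg _))

/-- Steklov averages of a continuous source, tested with convergent functions. -/
lemma tendsto_integral_average_inner_of_continuous {g : ℝ → H} (hg : Continuous g)
    {p : ℝ → ℝ → H} {p₀ : ℝ → H} {t M : ℝ} (ht : 0 ≤ t)
    (hp : ∀ h, Continuous (p h))
    (hM : ∀ h ∈ Ioc (0 : ℝ) 1, ∀ s ∈ Icc (0 : ℝ) t, ‖p h s‖ ≤ M)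
    (hlim : ∀ s ∈ Icc (0 : ℝ) t, Tendsto (fun h => p h s) (𝓝[>] 0) (𝓝 (p₀ s))) :
    Tendsto (fun h : ℝ => h⁻¹ * ∫ s in (0 : ℝ)..t, ⟪∫ r in s..s + h, g r, p h s⟫) (𝓝[>] 0)
      (𝓝 (∫ s in (0 : ℝ)..t, ⟪g s, p₀ s⟫)) := by
  have hM0 : 0 ≤ M :=
    (norm_nonneg _).trans (hM 1 (by simp) 0 ⟨le_rfl, ht⟩)
  obtain ⟨K, hK⟩ := (isCompact_Icc (a := (0 : ℝ)) (b := t + 1)).exists_bound_of_continuousOn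
    hg.continuousOn
  have hmem : Ioc (0 : ℝ) 1 ∈ 𝓝[>] (0 : ℝ) := Ioc_mem_nhdsGT one_pos
  have hW := continuous_integral_window fun a b => hg.intervalIntegrable (μ := volume) a b
  have key : Tendsto (fun h : ℝ => ∫ s in (0 : ℝ)..t, ⟪h⁻¹ • ∫ r in s..s + h, g r, p h s⟫)
      (𝓝[>] 0) (𝓝 (∫ s in (0 : ℝ)..t, ⟪g s, p₀ s⟫)) := by
    refine intervalIntegral.tendsto_integral_filter_of_dominated_convergence (fun _ => K * M)
      ?_ ?_ (by simp) ?_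
    · refine Eventually.of_forall fun h => Continuous.aestronglyMeasurable ?_
      exact ((hW h).const_smul _).inner (hp h)
    · filter_upwards [hmem] with h hh
      refine Eventually.of_forall fun s hs => ?_
      rw [uIoc_of_le ht] at hs
      have h1 : ‖h⁻¹ • ∫ r in s..s + h, g r‖ ≤ K := by
        have h2 : ‖∫ r in s..s + h, g r‖ ≤ K * |s + h - s| := by
          refine intervalIntegral.norm_integral_le_of_norm_le_const fun r hr => ?_
          rw [uIoc_of_le (by linarith [hh.1])] at hr
          exact hK r ⟨by linarith [hr.1, hs.1], by linarith [hr.2, hs.2, hh.2]⟩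
        rw [add_sub_cancel_left, abs_of_pos hh.1] at h2
        rw [norm_smul, norm_inv, Real.norm_of_nonneg hh.1.le, inv_mul_le_iff₀ hh.1]
        linarith
      refine (norm_inner_le_norm _ _).trans ?_
      exact mul_le_mul h1 (hM h hh s ⟨hs.1.le, hs.2⟩) (norm_nonneg _) ((norm_nonneg _).trans h1)
    · refine Eventually.of_forall fun s hs => ?_
      rw [uIoc_of_le ht] at hs
      exact (tendsto_average hg s).inner (hlim s ⟨hs.1.le, hs.2⟩)
  refine key.congr fun h => ?_
  rw [← intervalIntegral.integral_const_mul]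
  simp only [real_inner_smul_left]

/-- Steklov averages of a locally integrable source, tested with convergent functions. -/
lemma tendsto_integral_average_inner {g : ℝ → H}
    {p : ℝ → ℝ → H} {p₀ : ℝ → H} {t M : ℝ} (ht : 0 ≤ t)
    (hg : IntervalIntegrable g volume 0 (t + 1))
    (hp : ∀ h, Continuous (p h)) (hp₀ : Continuous p₀)
    (hM : ∀ h ∈ Ioc (0 : ℝ) 1, ∀ s ∈ Icc (0 : ℝ) t, ‖p h s‖ ≤ M)
    (hlim : ∀ s ∈ Icc (0 : ℝ) t, Tendsto (fun h => p h s) (𝓝[>] 0) (𝓝 (p₀ s))) :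
    Tendsto (fun h : ℝ => h⁻¹ * ∫ s in (0 : ℝ)..t, ⟪∫ r in s..s + h, g r, p h s⟫) (𝓝[>] 0)
      (𝓝 (∫ s in (0 : ℝ)..t, ⟪g s, p₀ s⟫)) := by
  have hM0 : 0 ≤ M :=
    (norm_nonneg _).trans (hM 1 (by simp) 0 ⟨le_rfl, ht⟩)
  have hmem : Ioc (0 : ℝ) 1 ∈ 𝓝[>] (0 : ℝ) := Ioc_mem_nhdsGT one_pos
  have hM₀ : ∀ s ∈ Icc (0 : ℝ) t, ‖p₀ s‖ ≤ M := fun s hs =>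
    le_of_tendsto (hlim s hs).norm (by filter_upwards [hmem] with h hh using hM h hh s hs)
  -- Windows starting in `[0, t]` with `h ≤ 1` see `g` only on `(0, t + 1]`.
  set G : ℝ → H := (Ioc (0 : ℝ) (t + 1)).indicator g with hG
  have hGint : Integrable G := by
    rw [hG, integrable_indicator_iff measurableSet_Ioc]
    exact (intervalIntegrable_iff_integrableOn_Ioc_of_le (by linarith)).1 hg
  have hGg : ∀ a b : ℝ, 0 ≤ a → a ≤ b → b ≤ t + 1 → EqOn g G (Ioc a b) := by
    intro a b ha hab hb x hx
    have hx' : x ∈ Ioc (0 : ℝ) (t + 1) := ⟨ha.trans_lt hx.1, hx.2.trans hb⟩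
    rw [hG, indicator_of_mem hx']
  rw [Metric.tendsto_nhds]
  intro ε hε
  -- Three errors are added: less than `δ` for the continuous part, and at most `δ M` for the
  -- remainder in each of the average and the limit.
  set δ : ℝ := ε / (2 * M + 2) with hδ
  have hδ0 : 0 < δ := by positivity
  obtain ⟨k, -, hk, hkc, hki⟩ := hGint.exists_hasCompactSupport_integral_sub_le hδ0
  set r : ℝ → H := fun s => G s - k s with hr
  have hrint : Integrable r := hGint.sub hki
  have hri : ∀ a b : ℝ, IntervalIntegrable r volume a b := fun a b => hrint.intervalIntegrable
  have hrn : ∀ a b : ℝ, IntervalIntegrable (fun s => ‖r s‖) volume a b := fun a b => (hri a b).norm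
  -- The window integral of the remainder at `s` is bounded by `ρ (s + h) - ρ s`, an increment of a
  -- monotone function.
  set ρ : ℝ → ℝ := fun s => ∫ x in (0 : ℝ)..s, ‖r x‖ with hρ
  have hρc : Continuous ρ := intervalIntegral.continuous_primitive hrn 0
  have hρsub : ∀ a b : ℝ, ρ b - ρ a = ∫ x in a..b, ‖r x‖ := fun a b =>
    intervalIntegral.integral_interval_sub_left (hrn _ _) (hrn _ _)
  have hρm : MonotoneOn ρ (Ici 0) := by
    intro a _ b _ hab
    have := hρsub a b
    have h2 : 0 ≤ ∫ x in a..b, ‖r x‖ :=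
      intervalIntegral.integral_nonneg hab fun x _ => norm_nonneg _
    linarith
  have hρle : ∀ s, 0 ≤ s → ρ s ≤ δ := by
    intro s hs
    refine le_trans ?_ hk
    simp only [hρ]
    rw [intervalIntegral.integral_of_le hs]
    exact setIntegral_le_integral hrint.norm (Eventually.of_forall fun x => norm_nonneg _)
  have hW := continuous_integral_window hri
  have hV := continuous_integral_window fun a b => hkc.intervalIntegrable (μ := volume) a b
  have hlimk := tendsto_integral_average_inner_of_continuous hkc ht hp hM hlim
  rw [Metric.tendsto_nhds] at hlimk
  filter_upwards [hlimk δ hδ0, hmem] with h h1 hh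
  have h2 : h⁻¹ * ∫ s in (0 : ℝ)..t, ⟪∫ x in s..s + h, g x, p h s⟫ =
      h⁻¹ * (∫ s in (0 : ℝ)..t, ⟪∫ x in s..s + h, k x, p h s⟫) +
      h⁻¹ * ∫ s in (0 : ℝ)..t, ⟪∫ x in s..s + h, r x, p h s⟫ := by
    rw [← mul_add, ← intervalIntegral.integral_add
      (((hV h).inner (hp h)).intervalIntegrable _ _)
      (((hW h).inner (hp h)).intervalIntegrable _ _)]
    congr 1
    refine intervalIntegral.integral_congr fun s hs => ?_
    rw [uIcc_of_le ht] at hs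
    rw [← inner_add_left, ← intervalIntegral.integral_add (hkc.intervalIntegrable _ _) (hri _ _)]
    congr 1
    rw [intervalIntegral.integral_of_le (by linarith [hh.1]),
      intervalIntegral.integral_of_le (by linarith [hh.1])]
    refine setIntegral_congr_fun measurableSet_Ioc fun x hx => ?_
    simp only [hr]
    rw [hGg s (s + h) hs.1 (by linarith [hh.1]) (by linarith [hs.2, hh.2]) hx]
    abel
  have h3 : ∫ s in (0 : ℝ)..t, ⟪g s, p₀ s⟫ =
      (∫ s in (0 : ℝ)..t, ⟪k s, p₀ s⟫) + ∫ s in (0 : ℝ)..t, ⟪r s, p₀ s⟫ := by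
    have hrp : IntervalIntegrable (fun s => ⟪r s, p₀ s⟫) volume 0 t :=
      intervalIntegrable_inner (hri 0 t) hp₀
    rw [← intervalIntegral.integral_add ((hkc.inner hp₀).intervalIntegrable _ _) hrp,
      intervalIntegral.integral_of_le ht, intervalIntegral.integral_of_le ht]
    refine setIntegral_congr_fun measurableSet_Ioc fun x hx => ?_
    simp only [hr]
    rw [hGg 0 t le_rfl ht (by linarith) hx, ← inner_add_left]
    congr 1
    abel
  have h4 : ‖h⁻¹ * ∫ s in (0 : ℝ)..t, ⟪∫ x in s..s + h, r x, p h s⟫‖ ≤ δ * M := by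
    rw [norm_mul, norm_inv, Real.norm_of_nonneg hh.1.le, inv_mul_le_iff₀ hh.1]
    have h5 : ‖∫ s in (0 : ℝ)..t, ⟪∫ x in s..s + h, r x, p h s⟫‖ ≤
        ∫ s in (0 : ℝ)..t, (ρ (s + h) - ρ s) * M := by
      refine intervalIntegral.norm_integral_le_of_norm_le ht ?_ ?_
      · refine Eventually.of_forall fun s hs => ?_
        refine (norm_inner_le_norm _ _).trans ?_
        refine mul_le_mul ?_ (hM h hh s ⟨hs.1.le, hs.2⟩) (norm_nonneg _) ?_
        · rw [hρsub]
          exact intervalIntegral.norm_integral_le_integral_norm (by linarith [hh.1])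
        · rw [hρsub]
          exact intervalIntegral.integral_nonneg (by linarith [hh.1]) fun x _ => norm_nonneg _
      · exact (((hρc.comp (continuous_add_const h)).sub hρc).mul
          continuous_const).intervalIntegrable _ _
    rw [intervalIntegral.integral_mul_const] at h5
    have h6 := integral_increment_le hρc hρm (by simp [hρ]) ht hh.1.le
    have h7 : h * ρ (t + h) ≤ h * δ :=
      mul_le_mul_of_nonneg_left (hρle _ (by linarith [hh.1])) hh.1.le
    calc _ ≤ _ := h5
      _ ≤ (h * δ) * M := mul_le_mul_of_nonneg_right (h6.trans h7) hM0
      _ = _ := by ring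
  have h8 : ‖∫ s in (0 : ℝ)..t, ⟪r s, p₀ s⟫‖ ≤ δ * M := by
    have h5 : ‖∫ s in (0 : ℝ)..t, ⟪r s, p₀ s⟫‖ ≤ ∫ s in (0 : ℝ)..t, ‖r s‖ * M := by
      refine intervalIntegral.norm_integral_le_of_norm_le ht ?_ ((hrn 0 t).mul_const M)
      refine Eventually.of_forall fun s hs => ?_
      exact (norm_inner_le_norm _ _).trans
          (mul_le_mul_of_nonneg_left (hM₀ s ⟨hs.1.le, hs.2⟩) (norm_nonneg _))
    rw [intervalIntegral.integral_mul_const] at h5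
    exact h5.trans (mul_le_mul_of_nonneg_right (hρle t ht) hM0)
  rw [Real.dist_eq] at h1 ⊢
  rw [h2, h3]
  rw [Real.norm_eq_abs] at h4 h8
  have h9 : ε = δ * (2 * M + 2) := by
    rw [hδ]; field_simp
  rw [abs_lt] at h1 ⊢
  rw [abs_le] at h4 h8
  constructor <;> nlinarith [h1.1, h1.2, h4.1, h4.2, h8.1, h8.2]

end SteklovSource

/-! ### Energy and virial identities for the abstract damped wave equation. -/

section DampedWave

variable {X H : Type*} [NormedAddCommGroup X] [InnerProductSpace ℝ X]
  [NormedAddCommGroup H] [InnerProductSpace ℝ H]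

/-- `u`, with `v = ∂_t (j u)`, solves weakly `∂_t² u + 2α ∂_t u + A u = g` on `[0, ∞)`, where `A` is
the operator associated with the inner product of the energy space `S`. -/
structure IsWeakDampedWave (S : Submodule ℝ X) (j : X →L[ℝ] H) (α : ℝ) (u : ℝ → X) (v g : ℝ → H) :
    Prop where
  continuous_fst : Continuous u
  continuous_snd : Continuous v
  mem : ∀ t, u t ∈ S
  hasDeriv : ∀ t, 0 ≤ t → HasDerivWithinAt (fun s => j (u s)) (v t) (Ici t) t
  intervalIntegrable : ∀ t, 0 ≤ t → IntervalIntegrable g volume 0 t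
  equation : ∀ t, 0 ≤ t → ∀ w ∈ S,
    ⟪v t, j w⟫ - ⟪v 0, j w⟫ + 2 * α * (⟪j (u t), j w⟫ - ⟪j (u 0), j w⟫)
      + ⟪∫ s in (0 : ℝ)..t, u s, w⟫ - ⟪∫ s in (0 : ℝ)..t, g s, j w⟫ = 0

namespace IsWeakDampedWave

variable {S : Submodule ℝ X} {j : X →L[ℝ] H} {α : ℝ} {u : ℝ → X} {v g : ℝ → H}

/-- The difference of the integrated equation at two times. The test vector may now depend on `s`
and `h`, so that `u (s + h) - u s`, which lies in `S`, can replace the inadmissible `v`. -/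
lemma equation_increment (hu : IsWeakDampedWave S j α u v g) {s h : ℝ} (hs : 0 ≤ s) (hh : 0 ≤ h)
    {w : X} (hw : w ∈ S) :
    ⟪v (s + h) - v s, j w⟫ + 2 * α * ⟪j (u (s + h) - u s), j w⟫
      + ⟪∫ r in s..s + h, u r, w⟫ - ⟪∫ r in s..s + h, g r, j w⟫ = 0 := by
  have h1 := hu.equation (s + h) (by linarith) w hw
  have h2 := hu.equation s hs w hw
  rw [← intervalIntegral.integral_interval_sub_left (hu.continuous_fst.intervalIntegrable 0 (s + h))
    (hu.continuous_fst.intervalIntegrable 0 s),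
    ← intervalIntegral.integral_interval_sub_left (hu.intervalIntegrable (s + h) (by linarith))
    (hu.intervalIntegrable s hs), map_sub, inner_sub_left, inner_sub_left, inner_sub_left,
    inner_sub_left]
  linarith

lemma hasDeriv_shift (hu : IsWeakDampedWave S j α u v g) {s h : ℝ} (hs : 0 ≤ s) (hh : 0 ≤ h) :
    HasDerivWithinAt (fun s => j (u (s + h))) (v (s + h)) (Ici s) s := by
  have h1 : HasDerivWithinAt (fun s : ℝ => s + h) 1 (Ici s) s :=
    ((hasDerivAt_id s).add_const h).hasDerivWithinAt
  have h2 := (hu.hasDeriv (s + h) (by linarith)).scomp s h1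
    (fun x hx => by simpa using hx)
  simpa [Function.comp_def] using h2

lemma tendsto_slope (hu : IsWeakDampedWave S j α u v g) {s : ℝ} (hs : 0 ≤ s) :
    Tendsto (fun h : ℝ => h⁻¹ • j (u (s + h) - u s)) (𝓝[>] 0) (𝓝 (v s)) := by
  have h1 := hasDerivWithinAt_iff_tendsto_slope.1 (hu.hasDeriv s hs)
  rw [Ici_sdiff_left] at h1
  have h2 : Tendsto (fun h : ℝ => s + h) (𝓝[>] 0) (𝓝[>] s) := by
    refine tendsto_nhdsWithin_iff.2 ⟨?_, ?_⟩
    · have : Tendsto (fun h : ℝ => s + h) (𝓝 0) (𝓝 (s + 0)) :=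
        (continuous_const.add continuous_id).tendsto 0
      rw [add_zero] at this
      exact this.mono_left nhdsWithin_le_nhds
    · filter_upwards [self_mem_nhdsWithin] with h hh
      simpa using hh
  refine (h1.comp h2).congr fun h => ?_
  simp [slope_def_module, map_sub]

/-- The mean value inequality; the bound is uniform in `h` and serves as the majorant in dominated
convergence. -/
lemma norm_increment_le (hu : IsWeakDampedWave S j α u v g) {t M : ℝ}
    (hM : ∀ s ∈ Icc (0 : ℝ) (t + 1), ‖v s‖ ≤ M) {s h : ℝ} (hs : s ∈ Icc (0 : ℝ) t)
    (hh : h ∈ Ioc (0 : ℝ) 1) : ‖h⁻¹ • j (u (s + h) - u s)‖ ≤ M := by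
  have h1 : ‖j (u (s + h)) - j (u s)‖ ≤ M * (s + h - s) := by
    refine norm_image_sub_le_of_norm_deriv_right_le_segment (a := s) (b := s + h)
      (j.continuous.comp hu.continuous_fst).continuousOn
      (fun x hx => hu.hasDeriv x (hs.1.trans hx.1)) (fun x hx => hM x ?_) (s + h) ?_
    · exact ⟨hs.1.trans hx.1, by linarith [hx.2, hs.2, hh.2]⟩
    · exact ⟨by linarith [hh.1], le_rfl⟩
  rw [norm_smul, norm_inv, Real.norm_of_nonneg hh.1.le, inv_mul_le_iff₀ hh.1, map_sub]
  linarith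

lemma exists_bound (hu : IsWeakDampedWave S j α u v g) (t : ℝ) :
    ∃ M, ∀ s ∈ Icc (0 : ℝ) (t + 1), ‖v s‖ ≤ M :=
  isCompact_Icc.exists_bound_of_continuousOn hu.continuous_snd.continuousOn

lemma continuous_increment (hu : IsWeakDampedWave S j α u v g) (h : ℝ) :
    Continuous fun s => j (u (s + h) - u s) :=
  j.continuous.comp ((hu.continuous_fst.comp (continuous_add_const h)).sub hu.continuous_fst)

variable [CompleteSpace X]

/-- The energy identity for the increments of the solution. -/
lemma energy_increment (hu : IsWeakDampedWave S j α u v g) {t h : ℝ} (ht : 0 ≤ t) (hh : 0 < h) :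
    1 / 2 * ‖j (u (t + h) - u t)‖ ^ 2 - 1 / 2 * ‖j (u (0 + h) - u 0)‖ ^ 2
      + 2 * α * (∫ s in (0 : ℝ)..t, ‖j (u (s + h) - u s)‖ ^ 2)
      + (1 / 2 * ‖∫ r in t..t + h, u r‖ ^ 2 - 1 / 2 * ‖∫ r in (0 : ℝ)..0 + h, u r‖ ^ 2)
      = ∫ s in (0 : ℝ)..t, ⟪∫ r in s..s + h, g r, j (u (s + h) - u s)⟫ := by
  have hcu := hu.continuous_fst
  have hcv := hu.continuous_snd
  have hJ := hu.continuous_increment h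
  have hW : Continuous fun s : ℝ => ∫ r in s..s + h, u r :=
    continuous_integral_window (fun a b => hcu.intervalIntegrable a b) h
  have hδ : Continuous fun s : ℝ => u (s + h) - u s :=
    (hcu.comp (continuous_add_const h)).sub hcu
  have hδv : Continuous fun s : ℝ => v (s + h) - v s :=
    (hcv.comp (continuous_add_const h)).sub hcv
  have i1 : ∫ s in (0 : ℝ)..t, ⟪v (s + h) - v s, j (u (s + h) - u s)⟫ =
      1 / 2 * ‖j (u (t + h) - u t)‖ ^ 2 - 1 / 2 * ‖j (u (0 + h) - u 0)‖ ^ 2 := by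
    refine intervalIntegral.integral_eq_sub_of_hasDeriv_right_of_le
      (f := fun s => 1 / 2 * ‖j (u (s + h) - u s)‖ ^ 2) ht
      (continuous_const.mul (hJ.norm.pow 2)).continuousOn (fun s hs => ?_)
      ((hδv.inner hJ).intervalIntegrable _ _)
    have h1 : HasDerivWithinAt (fun s => j (u (s + h) - u s)) (v (s + h) - v s) (Ioi s) s := by
      simp only [map_sub]
      exact ((hu.hasDeriv_shift hs.1.le hh.le).sub (hu.hasDeriv s hs.1.le)).mono Ioi_subset_Ici_self
    have h2 := (h1.norm_sq).const_mul (1 / 2 : ℝ)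
    refine h2.congr_deriv ?_
    rw [real_inner_comm]
    ring
  -- The increment of `u` is the derivative of its window integral, so the elastic term is an exact
  -- derivative too.
  have i2 : ∫ s in (0 : ℝ)..t, ⟪∫ r in s..s + h, u r, u (s + h) - u s⟫ =
      1 / 2 * ‖∫ r in t..t + h, u r‖ ^ 2 - 1 / 2 * ‖∫ r in (0 : ℝ)..0 + h, u r‖ ^ 2 := by
    refine intervalIntegral.integral_eq_sub_of_hasDeriv_right_of_le
      (f := fun s => 1 / 2 * ‖∫ r in s..s + h, u r‖ ^ 2) ht
      (continuous_const.mul (hW.norm.pow 2)).continuousOn (fun s _ => ?_)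
      ((hW.inner hδ).intervalIntegrable _ _)
    have h0 : ∀ x, HasDerivAt (fun s : ℝ => ∫ r in (0 : ℝ)..s, u r) (u x) x := fun x =>
      (hcu.integral_hasStrictDerivAt 0 x).hasDerivAt
    have h1 : HasDerivAt (fun s : ℝ => ∫ r in s..s + h, u r) (u (s + h) - u s) s := by
      refine (((h0 (s + h)).comp_add_const s h).sub (h0 s)).congr_of_eventuallyEq ?_
      refine Eventually.of_forall fun s => ?_
      exact (intervalIntegral.integral_interval_sub_left (hcu.intervalIntegrable _ _)
        (hcu.intervalIntegrable _ _)).symm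
    have h2 := ((h1.hasDerivWithinAt (s := Ioi s)).norm_sq).const_mul (1 / 2 : ℝ)
    refine h2.congr_deriv ?_
    ring
  have i3 : ∫ s in (0 : ℝ)..t, ⟪∫ r in s..s + h, g r, j (u (s + h) - u s)⟫ =
      ∫ s in (0 : ℝ)..t, (⟪v (s + h) - v s, j (u (s + h) - u s)⟫
        + 2 * α * ‖j (u (s + h) - u s)‖ ^ 2
        + ⟪∫ r in s..s + h, u r, u (s + h) - u s⟫) := by
    refine intervalIntegral.integral_congr fun s hs => ?_
    rw [uIcc_of_le ht] at hs
    have h1 := hu.equation_increment hs.1 hh.le (S.sub_mem (hu.mem (s + h)) (hu.mem s))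
    rw [real_inner_self_eq_norm_sq] at h1
    linarith
  rw [i3, intervalIntegral.integral_add, intervalIntegral.integral_add, i1, i2,
    intervalIntegral.integral_const_mul]
  · exact (hδv.inner hJ).intervalIntegrable _ _
  · exact (continuous_const.mul (hJ.norm.pow 2)).intervalIntegrable _ _
  · exact ((hδv.inner hJ).add (continuous_const.mul (hJ.norm.pow 2))).intervalIntegrable _ _
  · exact (hW.inner hδ).intervalIntegrable _ _

variable [CompleteSpace H]

/-- The energy identity. -/
theorem energy_identity (hu : IsWeakDampedWave S j α u v g) {t : ℝ} (ht : 0 ≤ t) :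
    1 / 2 * ‖v t‖ ^ 2 - 1 / 2 * ‖v 0‖ ^ 2 + 2 * α * (∫ s in (0 : ℝ)..t, ‖v s‖ ^ 2)
      + (1 / 2 * ‖u t‖ ^ 2 - 1 / 2 * ‖u 0‖ ^ 2) = ∫ s in (0 : ℝ)..t, ⟪g s, v s⟫ := by
  obtain ⟨M, hM⟩ := hu.exists_bound t
  have hmem : Ioc (0 : ℝ) 1 ∈ 𝓝[>] (0 : ℝ) := Ioc_mem_nhdsGT one_pos
  have hsq : ∀ (h : ℝ) (x : X), ‖h⁻¹ • x‖ ^ 2 = h⁻¹ ^ 2 * ‖x‖ ^ 2 := fun h x => by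
    rw [norm_smul, mul_pow, norm_inv, Real.norm_eq_abs, inv_pow, inv_pow, sq_abs]
  have hsq' : ∀ (h : ℝ) (x : H), ‖h⁻¹ • x‖ ^ 2 = h⁻¹ ^ 2 * ‖x‖ ^ 2 := fun h x => by
    rw [norm_smul, mul_pow, norm_inv, Real.norm_eq_abs, inv_pow, inv_pow, sq_abs]
  have l1 : ∀ s, 0 ≤ s → Tendsto (fun h : ℝ => h⁻¹ ^ 2 * ‖j (u (s + h) - u s)‖ ^ 2) (𝓝[>] 0)
      (𝓝 (‖v s‖ ^ 2)) := fun s hs =>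
    ((hu.tendsto_slope hs).norm.pow 2).congr fun h => hsq' h _
  have l2 : ∀ s, Tendsto (fun h : ℝ => h⁻¹ ^ 2 * ‖∫ r in s..s + h, u r‖ ^ 2) (𝓝[>] 0)
      (𝓝 (‖u s‖ ^ 2)) := fun s =>
    ((tendsto_average hu.continuous_fst s).norm.pow 2).congr fun h => hsq h _
  have l3 : Tendsto (fun h : ℝ => ∫ s in (0 : ℝ)..t, h⁻¹ ^ 2 * ‖j (u (s + h) - u s)‖ ^ 2) (𝓝[>] 0)
      (𝓝 (∫ s in (0 : ℝ)..t, ‖v s‖ ^ 2)) := by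
    refine intervalIntegral.tendsto_integral_filter_of_dominated_convergence (fun _ => M ^ 2)
      ?_ ?_ (by simp) ?_
    · exact Eventually.of_forall fun h =>
        (continuous_const.mul ((hu.continuous_increment h).norm.pow 2)).aestronglyMeasurable
    · filter_upwards [hmem] with h hh
      refine Eventually.of_forall fun s hs => ?_
      rw [uIoc_of_le ht] at hs
      rw [← hsq', norm_pow, norm_norm]
      exact pow_le_pow_left₀ (norm_nonneg _) (hu.norm_increment_le hM ⟨hs.1.le, hs.2⟩ hh) 2
    · refine Eventually.of_forall fun s hs => l1 s ?_
      rw [uIoc_of_le ht] at hs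
      exact hs.1.le
  -- The increment identity is divided by `h²`: one factor averages the source, the other makes the
  -- test function a difference quotient converging to `v`.
  have l4 := tendsto_integral_average_inner (g := g)
    (p := fun h s => h⁻¹ • j (u (s + h) - u s)) ht (hu.intervalIntegrable _ (by linarith))
    (fun h => (hu.continuous_increment h).const_smul _) hu.continuous_snd
    (fun h hh s hs => hu.norm_increment_le hM hs hh) (fun s hs => hu.tendsto_slope hs.1)
  have l5 := ((((l1 t ht).const_mul (1 / 2)).sub ((l1 0 le_rfl).const_mul (1 / 2))).add
    (l3.const_mul (2 * α))).add (((l2 t).const_mul (1 / 2)).sub ((l2 0).const_mul (1 / 2)))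
  refine tendsto_nhds_unique (l5.congr' ?_) l4
  filter_upwards [hmem] with h hh
  have h1 := hu.energy_increment ht hh.1
  rw [intervalIntegral.integral_const_mul]
  simp only [real_inner_smul_right]
  rw [intervalIntegral.integral_const_mul, ← h1]
  ring

/-- The virial identity, obtained by testing the equation with the solution. -/
theorem virial_identity (hu : IsWeakDampedWave S j α u v g) {t : ℝ} (ht : 0 ≤ t) :
    ⟪v t, j (u t)⟫ - ⟪v 0, j (u 0)⟫ =
      ∫ s in (0 : ℝ)..t, (‖v s‖ ^ 2 - 2 * α * ⟪v s, j (u s)⟫ - ‖u s‖ ^ 2 + ⟪g s, j (u s)⟫) := by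
  obtain ⟨M, hM⟩ := hu.exists_bound t
  have hcu := hu.continuous_fst
  have hcv := hu.continuous_snd
  have hju : Continuous fun s => j (u s) := j.continuous.comp hcu
  have hmem : Ioc (0 : ℝ) 1 ∈ 𝓝[>] (0 : ℝ) := Ioc_mem_nhdsGT one_pos
  obtain ⟨K, hK⟩ := isCompact_Icc.exists_bound_of_continuousOn (s := Icc (0 : ℝ) (t + 1))
    hju.continuousOn
  obtain ⟨N, hN⟩ := isCompact_Icc.exists_bound_of_continuousOn (s := Icc (0 : ℝ) (t + 1))
    hcu.continuousOn
  have hδ : ∀ h, Continuous fun s => h⁻¹ • j (u (s + h) - u s) := fun h =>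
    (hu.continuous_increment h).const_smul _
  have hW : ∀ h, Continuous fun s : ℝ => ∫ r in s..s + h, u r :=
    continuous_integral_window (fun a b => hcu.intervalIntegrable a b)
  -- Discrete product rule: `⟪v(s+h) - v(s), j u(s)⟫` is the increment of `⟪v, j u⟫` minus `⟪v(s+h),
  -- j(u(s+h) - u(s))⟫`. The limits `l1` and `l2` treat the two parts.
  have l1 := tendsto_integral_difference (hcv.inner hju) t
  have l2 : Tendsto (fun h : ℝ => ∫ s in (0 : ℝ)..t, ⟪v (s + h), h⁻¹ • j (u (s + h) - u s)⟫)
      (𝓝[>] 0) (𝓝 (∫ s in (0 : ℝ)..t, ‖v s‖ ^ 2)) := by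
    refine intervalIntegral.tendsto_integral_filter_of_dominated_convergence (fun _ => M * M)
      ?_ ?_ (by simp) ?_
    · exact Eventually.of_forall fun h =>
        ((hcv.comp (continuous_add_const h)).inner (hδ h)).aestronglyMeasurable
    · filter_upwards [hmem] with h hh
      refine Eventually.of_forall fun s hs => ?_
      rw [uIoc_of_le ht] at hs
      have h1 : ‖v (s + h)‖ ≤ M := hM _ ⟨by linarith [hs.1, hh.1], by linarith [hs.2, hh.2]⟩
      exact (norm_inner_le_norm _ _).trans (mul_le_mul h1
        (hu.norm_increment_le hM ⟨hs.1.le, hs.2⟩ hh) (norm_nonneg _) ((norm_nonneg _).trans h1))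
    · refine Eventually.of_forall fun s hs => ?_
      rw [uIoc_of_le ht] at hs
      rw [← real_inner_self_eq_norm_sq]
      refine Tendsto.inner ?_ (hu.tendsto_slope hs.1.le)
      have : Tendsto (fun h : ℝ => v (s + h)) (𝓝 0) (𝓝 (v (s + 0))) :=
        (hcv.comp (continuous_const_add s)).tendsto 0
      rw [add_zero] at this
      exact this.mono_left nhdsWithin_le_nhds
  have l3 : Tendsto (fun h : ℝ => ∫ s in (0 : ℝ)..t, ⟪h⁻¹ • j (u (s + h) - u s), j (u s)⟫)
      (𝓝[>] 0) (𝓝 (∫ s in (0 : ℝ)..t, ⟪v s, j (u s)⟫)) := by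
    refine intervalIntegral.tendsto_integral_filter_of_dominated_convergence (fun _ => M * K)
      ?_ ?_ (by simp) ?_
    · exact Eventually.of_forall fun h => ((hδ h).inner hju).aestronglyMeasurable
    · filter_upwards [hmem] with h hh
      refine Eventually.of_forall fun s hs => ?_
      rw [uIoc_of_le ht] at hs
      have h1 := hu.norm_increment_le hM ⟨hs.1.le, hs.2⟩ hh
      exact (norm_inner_le_norm _ _).trans (mul_le_mul h1
        (hK s ⟨hs.1.le, by linarith [hs.2]⟩) (norm_nonneg _) ((norm_nonneg _).trans h1))
    · refine Eventually.of_forall fun s hs => ?_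
      rw [uIoc_of_le ht] at hs
      exact (hu.tendsto_slope hs.1.le).inner tendsto_const_nhds
  have l4 := tendsto_integral_average_inner_of_continuous hcu (p := fun _ => u) (p₀ := u) ht
    (fun _ => hcu) (fun h _ s hs => hN s ⟨hs.1, by linarith [hs.2]⟩)
    (fun s _ => tendsto_const_nhds)
  have l5 := tendsto_integral_average_inner (g := g)
    (p := fun _ s => j (u s)) (p₀ := fun s => j (u s)) ht (hu.intervalIntegrable _ (by linarith))
    (fun _ => hju) hju (fun h _ s hs => hK s ⟨hs.1, by linarith [hs.2]⟩)
    (fun s _ => tendsto_const_nhds)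
  have l6 := ((l1.sub l2).add (l3.const_mul (2 * α))).add l4
  have key : ⟪v t, j (u t)⟫ - ⟪v 0, j (u 0)⟫ - (∫ s in (0 : ℝ)..t, ‖v s‖ ^ 2)
      + 2 * α * (∫ s in (0 : ℝ)..t, ⟪v s, j (u s)⟫) + ∫ s in (0 : ℝ)..t, ⟪u s, u s⟫
      = ∫ s in (0 : ℝ)..t, ⟪g s, j (u s)⟫ := by
    refine tendsto_nhds_unique (l6.congr' ?_) l5
    filter_upwards [hmem] with h hh
    have hvs : Continuous fun s => v (s + h) := hcv.comp (continuous_add_const h)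
    have hjs : Continuous fun s => j (u (s + h)) := hju.comp (continuous_add_const h)
    rw [← intervalIntegral.integral_const_mul, ← intervalIntegral.integral_const_mul,
      ← intervalIntegral.integral_const_mul, ← intervalIntegral.integral_const_mul,
      ← intervalIntegral.integral_sub, ← intervalIntegral.integral_add,
      ← intervalIntegral.integral_add]
    · refine intervalIntegral.integral_congr fun s hs => ?_
      rw [uIcc_of_le ht] at hs
      have h1 := hu.equation_increment hs.1 hh.1.le (hu.mem s)
      simp only [real_inner_smul_right, real_inner_smul_left, map_sub, inner_sub_left,
        inner_sub_right] at h1 ⊢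
      linear_combination h⁻¹ * h1
    · exact ((continuous_const.mul ((hvs.inner hjs).sub (hcv.inner hju))).sub
        (hvs.inner (hδ h))).add (continuous_const.mul ((hδ h).inner hju)) |>.intervalIntegrable _ _
    · exact (continuous_const.mul ((hW h).inner hcu)).intervalIntegrable _ _
    · exact ((continuous_const.mul ((hvs.inner hjs).sub (hcv.inner hju))).sub
        (hvs.inner (hδ h))).intervalIntegrable _ _
    · exact (continuous_const.mul ((hδ h).inner hju)).intervalIntegrable _ _
    · exact (continuous_const.mul ((hvs.inner hjs).sub (hcv.inner hju))).intervalIntegrable _ _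
    · exact (hvs.inner (hδ h)).intervalIntegrable _ _
  have c1 : Continuous fun s => ‖v s‖ ^ 2 := hcv.norm.pow 2
  have c2 : Continuous fun s => 2 * α * ⟪v s, j (u s)⟫ := continuous_const.mul (hcv.inner hju)
  have c3 : Continuous fun s => ‖u s‖ ^ 2 := hcu.norm.pow 2
  simp only [real_inner_self_eq_norm_sq] at key
  have c4 : Continuous fun s => ‖v s‖ ^ 2 - 2 * α * ⟪v s, j (u s)⟫ := c1.sub c2
  have c5 : Continuous fun s => ‖v s‖ ^ 2 - 2 * α * ⟪v s, j (u s)⟫ - ‖u s‖ ^ 2 := c4.sub c3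
  rw [intervalIntegral.integral_add (c5.intervalIntegrable _ _)
      (intervalIntegrable_inner (hu.intervalIntegrable t ht) hju),
    intervalIntegral.integral_sub (c4.intervalIntegrable _ _) (c3.intervalIntegrable _ _),
    intervalIntegral.integral_sub (c1.intervalIntegrable _ _) (c2.intervalIntegrable _ _),
    intervalIntegral.integral_const_mul]
  linarith

end IsWeakDampedWave

end DampedWave

/-! ### Levine's concavity argument. -/

section Concavity

/-- Levine's concavity argument in integrated form: a positive function `G` with derivative `D` such
that `D² ≤ 4 G P` and `D(t) ≥ D(0) + 4 (1 + κ) ∫₀ᵗ P` cannot exist for a long time. -/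
lemma concavity_contradiction {G D P : ℝ → ℝ} {κ T : ℝ} (hκ : 0 < κ) (hT : 0 < T)
    (hG : ∀ t, 0 ≤ t → HasDerivAt G (D t) t) (hP : Continuous P)
    (hGpos : ∀ t ∈ Icc 0 T, 0 < G t)
    (hP0 : ∀ t ∈ Icc 0 T, 0 ≤ P t)
    (hCS : ∀ t ∈ Icc 0 T, D t ^ 2 ≤ 4 * G t * P t)
    (hD : ∀ t ∈ Icc 0 T, D 0 + 4 * (1 + κ) * (∫ s in (0 : ℝ)..t, P s) ≤ D t)
    (hD0 : 0 < D 0) (hlarge : G 0 ≤ κ * D 0 * T) : False := by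
  -- `D` need not be differentiable; its lower bound `Λ` is, and replaces it in the monotone
  -- quantity below.
  set Λ : ℝ → ℝ := fun t => D 0 + 4 * (1 + κ) * ∫ s in (0 : ℝ)..t, P s with hΛ
  have hΛd : ∀ t, HasDerivAt Λ (4 * (1 + κ) * P t) t := fun t =>
    (((hP.integral_hasStrictDerivAt 0 t).hasDerivAt).const_mul _).const_add _
  have hΛpos : ∀ t ∈ Icc 0 T, D 0 ≤ Λ t := by
    intro t ht
    have : 0 ≤ ∫ s in (0 : ℝ)..t, P s :=
      intervalIntegral.integral_nonneg ht.1 fun s hs => hP0 s ⟨hs.1, hs.2.trans ht.2⟩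
    have : 0 ≤ 4 * (1 + κ) * ∫ s in (0 : ℝ)..t, P s := by positivity
    simp only [hΛ]
    linarith
  have hpow : ∀ (p : ℝ), ∀ t ∈ Icc 0 T,
      HasDerivAt (fun t => G t ^ p) (D t * p * G t ^ (p - 1)) t := fun p t ht =>
    (hG t ht.1).rpow_const (Or.inl (hGpos t ht).ne')
  have hint : interior (Icc 0 T) ⊆ Icc 0 T := interior_subset
  have hmono : MonotoneOn (fun t => Λ t * G t ^ (-(1 + κ))) (Icc 0 T) := by
    have hder : ∀ t ∈ Icc 0 T, HasDerivAt (fun t => Λ t * G t ^ (-(1 + κ)))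
        (4 * (1 + κ) * P t * G t ^ (-(1 + κ))
          + Λ t * (D t * (-(1 + κ)) * G t ^ (-(1 + κ) - 1))) t :=
      fun t ht => (hΛd t).mul (hpow _ t ht)
    refine monotoneOn_of_deriv_nonneg (convex_Icc 0 T)
      (fun t ht => (hder t ht).continuousAt.continuousWithinAt)
      (fun t ht => (hder t (hint ht)).differentiableAt.differentiableWithinAt) fun t ht => ?_
    have ht' := hint ht
    rw [(hder t ht').deriv]
    have hg := hGpos t ht'
    have h1 : G t ^ (-(1 + κ)) = G t * G t ^ (-(1 + κ) - 1) := by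
      rw [Real.rpow_sub_one hg.ne']
      field_simp
    rw [h1]
    have h2 : 0 < G t ^ (-(1 + κ) - 1) := Real.rpow_pos_of_pos hg _
    have h3 : Λ t * D t ≤ 4 * G t * P t := by
      have h4 := hD t ht'
      have h5 := hΛpos t ht'
      have h6 : 0 < D t := by linarith
      calc Λ t * D t ≤ D t * D t := mul_le_mul_of_nonneg_right h4 h6.le
        _ = D t ^ 2 := by ring
        _ ≤ _ := hCS t ht'
    have h7 : 4 * (1 + κ) * P t * (G t * G t ^ (-(1 + κ) - 1))
          + Λ t * (D t * (-(1 + κ)) * G t ^ (-(1 + κ) - 1))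
        = (1 + κ) * G t ^ (-(1 + κ) - 1) * (4 * G t * P t - Λ t * D t) := by ring
    rw [h7]
    have : 0 ≤ 4 * G t * P t - Λ t * D t := by linarith
    positivity
  -- By the monotonicity just proved, `D G^{-(1+κ)} ≥ c`, so `G^{-κ}` has slope at most `-κ c`.
  set c : ℝ := D 0 * G 0 ^ (-(1 + κ)) with hc
  have h0 : (0 : ℝ) ∈ Icc 0 T := ⟨le_rfl, hT.le⟩
  have hTT : T ∈ Icc 0 T := ⟨hT.le, le_rfl⟩
  have hanti : AntitoneOn (fun t => G t ^ (-κ) + κ * c * t) (Icc 0 T) := by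
    have hder : ∀ t ∈ Icc 0 T, HasDerivAt (fun t => G t ^ (-κ) + κ * c * t)
        (D t * (-κ) * G t ^ (-κ - 1) + κ * c * 1) t :=
      fun t ht => (hpow _ t ht).add ((hasDerivAt_id t).const_mul _)
    refine antitoneOn_of_deriv_nonpos (convex_Icc 0 T)
      (fun t ht => (hder t ht).continuousAt.continuousWithinAt)
      (fun t ht => (hder t (hint ht)).differentiableAt.differentiableWithinAt) fun t ht => ?_
    have ht' := hint ht
    rw [(hder t ht').deriv]
    have h1 : -κ - 1 = -(1 + κ) := by ring
    rw [h1]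
    have h2 : 0 < G t ^ (-(1 + κ)) := Real.rpow_pos_of_pos (hGpos t ht') _
    have h3 := hmono h0 ht' ht'.1
    have h4 : Λ 0 = D 0 := by simp [hΛ]
    simp only [h4] at h3
    have h5 := mul_le_mul_of_nonneg_right (hD t ht') h2.le
    have h6 : c ≤ D t * G t ^ (-(1 + κ)) := h3.trans h5
    nlinarith
  have h1 := hanti h0 hTT hT.le
  simp only [mul_zero, add_zero] at h1
  have h2 : 0 < G T ^ (-κ) := Real.rpow_pos_of_pos (hGpos T hTT) _
  have h3 : G 0 ^ (-κ) = G 0 * G 0 ^ (-(1 + κ)) := by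
    have : -(1 + κ) = -κ - 1 := by ring
    rw [this, Real.rpow_sub_one (hGpos 0 h0).ne']
    have := (hGpos 0 h0).ne'
    field_simp
  have h4 : 0 < G 0 ^ (-(1 + κ)) := Real.rpow_pos_of_pos (hGpos 0 h0) _
  rw [h3, hc] at h1
  -- The line bounds `G(T)^{-κ}` by `(G(0) - κ D(0) T) G(0)^{-(1+κ)} ≤ 0`, against positivity.
  nlinarith [mul_le_mul_of_nonneg_right hlarge h4.le]

end Concavity

/-! ### Blow-up for the abstract equation. -/

namespace IsWeakDampedWave

variable {X H : Type*} [NormedAddCommGroup X] [InnerProductSpace ℝ X] [CompleteSpace X]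
  [NormedAddCommGroup H] [InnerProductSpace ℝ H] [CompleteSpace H]
  {S : Submodule ℝ X} {j : X →L[ℝ] H} {α : ℝ} {u : ℝ → X} {v g : ℝ → H}

omit [CompleteSpace H] in
-- Cauchy–Schwarz for `(a(t), a, τ)` and `(b(t), b, 1)` in `H × L²((0,t); H) × ℝ` with weights `1,
-- 2α, β`, obtained from the discriminant of the quadratic `x ↦ ‖x a + b‖²` in this semi-norm.
lemma cauchy_schwarz (hα : 0 ≤ α) {a b : ℝ → H} (ha : Continuous a) (hb : Continuous b)
    {β τ t : ℝ} (hβ : 0 ≤ β) (ht : 0 ≤ t) :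
    (⟪a t, b t⟫ + 2 * α * (∫ s in (0 : ℝ)..t, ⟪a s, b s⟫) + β * τ) ^ 2 ≤
      (‖a t‖ ^ 2 + 2 * α * (∫ s in (0 : ℝ)..t, ‖a s‖ ^ 2) + β * τ ^ 2) *
      (‖b t‖ ^ 2 + 2 * α * (∫ s in (0 : ℝ)..t, ‖b s‖ ^ 2) + β) := by
  have h : ∀ x : ℝ, 0 ≤ (‖a t‖ ^ 2 + 2 * α * (∫ s in (0 : ℝ)..t, ‖a s‖ ^ 2) + β * τ ^ 2) * (x * x)
      + (2 * (⟪a t, b t⟫ + 2 * α * (∫ s in (0 : ℝ)..t, ⟪a s, b s⟫) + β * τ)) * x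
      + (‖b t‖ ^ 2 + 2 * α * (∫ s in (0 : ℝ)..t, ‖b s‖ ^ 2) + β) := by
    intro x
    have e : ∀ s, ‖x • a s + b s‖ ^ 2 =
        x * x * ‖a s‖ ^ 2 + 2 * x * ⟪a s, b s⟫ + ‖b s‖ ^ 2 := by
      intro s
      rw [norm_add_sq_real, real_inner_smul_left, norm_smul, mul_pow, Real.norm_eq_abs, sq_abs]
      ring
    have i : ∫ s in (0 : ℝ)..t, ‖x • a s + b s‖ ^ 2 =
        x * x * (∫ s in (0 : ℝ)..t, ‖a s‖ ^ 2) + 2 * x * (∫ s in (0 : ℝ)..t, ⟪a s, b s⟫)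
          + ∫ s in (0 : ℝ)..t, ‖b s‖ ^ 2 := by
      have c1 : Continuous fun s => x * x * ‖a s‖ ^ 2 := continuous_const.mul (ha.norm.pow 2)
      have c2 : Continuous fun s => 2 * x * ⟪a s, b s⟫ := continuous_const.mul (ha.inner hb)
      have c3 : Continuous fun s => ‖b s‖ ^ 2 := hb.norm.pow 2
      have c4 : Continuous fun s => x * x * ‖a s‖ ^ 2 + 2 * x * ⟪a s, b s⟫ := c1.add c2
      simp only [e]
      rw [intervalIntegral.integral_add (c4.intervalIntegrable _ _) (c3.intervalIntegrable _ _),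
        intervalIntegral.integral_add (c1.intervalIntegrable _ _) (c2.intervalIntegrable _ _),
        intervalIntegral.integral_const_mul, intervalIntegral.integral_const_mul]
    have h1 : 0 ≤ ∫ s in (0 : ℝ)..t, ‖x • a s + b s‖ ^ 2 :=
      intervalIntegral.integral_nonneg ht fun s _ => by positivity
    have h2 : 0 ≤ 2 * α * ∫ s in (0 : ℝ)..t, ‖x • a s + b s‖ ^ 2 := by positivity
    have h3 : 0 ≤ ‖x • a t + b t‖ ^ 2 := by positivity
    have h4 : 0 ≤ β * (x * τ + 1) ^ 2 := by positivity
    rw [i] at h2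
    rw [e] at h3
    nlinarith
  have h5 := discrim_le_zero h
  rw [discrim] at h5
  nlinarith

/-- A global solution with negative energy `E₀` cannot exist if the source satisfies the a.e. lower
bound given by an Ambrosetti–Rabinowitz condition and the conservation of energy. -/
theorem blowup (hu : IsWeakDampedWave S j α u v g) (hα : 0 ≤ α) {γ E₀ : ℝ} (hγ : 0 < γ)
    (hE₀ : E₀ < 0)
    (hsource : ∀ᵐ t : ℝ, 0 ≤ t → 2 * (1 + γ) * (1 / 2 * ‖u t‖ ^ 2 + 1 / 2 * ‖v t‖ ^ 2
      + 2 * α * (∫ s in (0 : ℝ)..t, ‖v s‖ ^ 2) - E₀) ≤ ⟪g t, j (u t)⟫) : False := by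
  have hcu := hu.continuous_fst
  have hcv := hu.continuous_snd
  set a : ℝ → H := fun s => j (u (max s 0)) with ha
  have hca : Continuous a := j.continuous.comp (hcu.comp (continuous_id.max continuous_const))
  have haj : ∀ s, 0 ≤ s → a s = j (u s) := fun s hs => by simp [ha, max_eq_left hs]
  set b : ℝ → H := fun s => v (max s 0) with hb
  have hcb : Continuous b := hcv.comp (continuous_id.max continuous_const)
  have hbv : ∀ s, 0 ≤ s → b s = v s := fun s hs => by simp [hb, max_eq_left hs]
  set y0 : ℝ := ‖a 0‖ ^ 2 with hy0
  -- the function `y = ‖u‖²`, extended to negative times as a differentiable function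
  set y : ℝ → ℝ := fun t => y0 + ∫ s in (0 : ℝ)..t, 2 * ⟪a s, b s⟫ with hy
  have hcab : Continuous fun s => 2 * ⟪a s, b s⟫ := continuous_const.mul (hca.inner hcb)
  have hyd : ∀ t, HasDerivAt y (2 * ⟪a t, b t⟫) t := fun t =>
    (hcab.integral_hasStrictDerivAt 0 t).hasDerivAt.const_add _
  have hya : ∀ t, 0 ≤ t → y t = ‖a t‖ ^ 2 := by
    intro t ht
    have : ∫ s in (0 : ℝ)..t, 2 * ⟪a s, b s⟫ = ‖a t‖ ^ 2 - ‖a 0‖ ^ 2 := by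
      refine intervalIntegral.integral_eq_sub_of_hasDeriv_right_of_le (f := fun s => ‖a s‖ ^ 2) ht
        (hca.norm.pow 2).continuousOn (fun s hs => ?_) (hcab.intervalIntegrable _ _)
      have h1 : HasDerivWithinAt a (b s) (Ioi s) s := by
        rw [hbv s hs.1.le]
        refine ((hu.hasDeriv s hs.1.le).mono Ioi_subset_Ici_self).congr (fun x hx => ?_) ?_
        · exact haj x (hs.1.le.trans (le_of_lt hx))
        · exact haj s hs.1.le
      exact h1.norm_sq
    simp only [hy]
    rw [this]
    ring
  have hcy : Continuous y := continuous_iff_continuousAt.2 fun t => (hyd t).continuousAt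
  -- With `β = -2E₀` and `κ = γ/2`, the coefficients of `‖v‖²` and of `β` match exactly in the
  -- virial estimate; what is left over is `γ ‖u‖² + 2γα ∫ ‖v‖² ≥ 0`.
  set β : ℝ := -2 * E₀ with hβ
  have hβ0 : 0 < β := by linarith
  set κ : ℝ := γ / 2 with hκ
  have hκ0 : 0 < κ := by positivity
  obtain ⟨τ, hτ0, hτ1, hτ2⟩ : ∃ τ : ℝ, 0 < τ ∧ 0 < ⟪a 0, b 0⟫ + β * τ ∧
      2 * α * y0 + 1 ≤ κ * (2 * (⟪a 0, b 0⟫ + β * τ)) := by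
    have h1 : Tendsto (fun τ : ℝ => ⟪a 0, b 0⟫ + β * τ) atTop atTop :=
      tendsto_atTop_add_const_left _ _ (tendsto_id.const_mul_atTop hβ0)
    have h2 : Tendsto (fun τ : ℝ => κ * (2 * (⟪a 0, b 0⟫ + β * τ))) atTop atTop :=
      (h1.const_mul_atTop two_pos).const_mul_atTop hκ0
    obtain ⟨τ, h3, h4, h5⟩ := ((eventually_gt_atTop 0).and
      ((h1.eventually_gt_atTop 0).and (h2.eventually_ge_atTop (2 * α * y0 + 1)))).exists
    exact ⟨τ, h3, h4, h5⟩
  -- Then `G 0 = (2α y0 + 1) T`, so the condition `G 0 ≤ κ D(0) T` reduces to `hτ2`, which does not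
  -- involve `T`.
  set T : ℝ := y0 + β * τ ^ 2 with hT
  have hy00 : 0 ≤ y0 := by positivity
  have hT0 : 0 < T := by positivity
  -- The term with `T - t` is nonnegative on `[0, T]`, and its derivative turns `2α y(t)` into `2α
  -- (y(t) - y0) = 4α ∫₀ᵗ ⟪a, b⟫`, as Cauchy–Schwarz requires.
  set G : ℝ → ℝ := fun t => y t + 2 * α * (∫ s in (0 : ℝ)..t, y s) + 2 * α * y0 * (T - t)
    + β * (t + τ) ^ 2 with hG
  set D : ℝ → ℝ := fun t => 2 * (⟪a t, b t⟫ + 2 * α * (∫ s in (0 : ℝ)..t, ⟪a s, b s⟫)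
    + β * (t + τ)) with hD
  set P : ℝ → ℝ := fun t => ‖b t‖ ^ 2 + 2 * α * (∫ s in (0 : ℝ)..t, ‖b s‖ ^ 2) + β with hP
  have hcb2 : Continuous fun s => ‖b s‖ ^ 2 := hcb.norm.pow 2
  have hI : Continuous fun t => ∫ s in (0 : ℝ)..t, ‖b s‖ ^ 2 :=
    intervalIntegral.continuous_primitive (fun a b => hcb2.intervalIntegrable a b) 0
  have hcP : Continuous P := (hcb2.add (continuous_const.mul hI)).add continuous_const
  have hI0 : ∀ t, 0 ≤ t → 0 ≤ ∫ s in (0 : ℝ)..t, ‖b s‖ ^ 2 := fun t ht =>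
    intervalIntegral.integral_nonneg ht fun s _ => by positivity
  have hyI : ∀ t, 0 ≤ t → ∫ s in (0 : ℝ)..t, y s = ∫ s in (0 : ℝ)..t, ‖a s‖ ^ 2 := by
    intro t ht
    refine intervalIntegral.integral_congr fun s hs => ?_
    rw [uIcc_of_le ht] at hs
    exact hya s hs.1
  have hyI0 : ∀ t, 0 ≤ t → 0 ≤ ∫ s in (0 : ℝ)..t, ‖a s‖ ^ 2 := fun t ht =>
    intervalIntegral.integral_nonneg ht fun s _ => by positivity
  refine concavity_contradiction (G := G) (D := D) (P := P) hκ0 hT0 (fun t ht => ?_) hcP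
    (fun t ht => ?_) (fun t ht => ?_) (fun t ht => ?_) (fun t ht => ?_) ?_ ?_
  · have h1 := (((hyd t).add ((hcy.integral_hasStrictDerivAt 0 t).hasDerivAt.const_mul
      (2 * α))).add (((hasDerivAt_id t).const_sub T).const_mul (2 * α * y0))).add
      ((((hasDerivAt_id t).add_const τ).pow 2).const_mul β)
    refine h1.congr_deriv ?_
    simp only [hD, hy, id]
    rw [intervalIntegral.integral_const_mul]
    push_cast
    ring
  · have h1 := hya t ht.1
    have h2 := hyI0 t ht.1
    have h3 : 0 ≤ T - t := by linarith [ht.2]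
    have h4 : 0 < t + τ := by linarith [ht.1]
    simp only [hG, h1, hyI t ht.1]
    positivity
  · have h1 := hI0 t ht.1
    simp only [hP]
    positivity
  · have h1 := cauchy_schwarz hα hca hcb (τ := t + τ) hβ0.le ht.1
    have h2 : ‖a t‖ ^ 2 + 2 * α * (∫ s in (0 : ℝ)..t, ‖a s‖ ^ 2) + β * (t + τ) ^ 2 ≤ G t := by
      have h3 : 0 ≤ 2 * α * y0 * (T - t) := by
        have : 0 ≤ T - t := by linarith [ht.2]
        positivity
      simp only [hG, hya t ht.1, hyI t ht.1]
      linarith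
    have h3 : 0 ≤ P t := by
      have h1 := hI0 t ht.1
      simp only [hP]
      positivity
    have h4 := mul_le_mul_of_nonneg_right h2 h3
    simp only [hD]
    nlinarith
  · have h1 := hu.virial_identity ht.1
    have hju : Continuous fun s => j (u s) := j.continuous.comp hcu
    have hgi := intervalIntegrable_inner (hu.intervalIntegrable t ht.1) hju
    have c1 : Continuous fun s => ‖v s‖ ^ 2 - 2 * α * ⟪v s, j (u s)⟫ - ‖u s‖ ^ 2 :=
      ((hcv.norm.pow 2).sub (continuous_const.mul (hcv.inner hju))).sub (hcu.norm.pow 2)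
    have c2 : Continuous fun s => 2 * α * ⟪v s, j (u s)⟫ := continuous_const.mul (hcv.inner hju)
    have c6 : Continuous fun s => 2 * (1 + κ) * P s := continuous_const.mul hcP
    have c3 : Continuous fun s => 2 * (1 + κ) * P s - β := c6.sub continuous_const
    have i1 := (c1.intervalIntegrable 0 t).add hgi (μ := volume)
    have h2 : ∫ s in (0 : ℝ)..t, (2 * (1 + κ) * P s - β) ≤
        ∫ s in (0 : ℝ)..t, ((‖v s‖ ^ 2 - 2 * α * ⟪v s, j (u s)⟫ - ‖u s‖ ^ 2 + ⟪g s, j (u s)⟫)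
          + 2 * α * ⟪v s, j (u s)⟫) := by
      refine intervalIntegral.integral_mono_ae_restrict ht.1 (c3.intervalIntegrable _ _)
        (i1.add (c2.intervalIntegrable _ _)) ?_
      refine (ae_restrict_iff' measurableSet_Icc).2 ?_
      filter_upwards [hsource] with s hs hst
      have h3 := hs hst.1
      have h4 : ∫ r in (0 : ℝ)..s, ‖b r‖ ^ 2 = ∫ r in (0 : ℝ)..s, ‖v r‖ ^ 2 := by
        refine intervalIntegral.integral_congr fun r hr => ?_
        rw [uIcc_of_le hst.1] at hr
        simp only [hbv r hr.1]
      have h5 := hI0 s hst.1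
      rw [h4] at h5
      simp only [hP, hbv s hst.1, h4]
      have h6 : 0 ≤ α * ∫ r in (0 : ℝ)..s, ‖v r‖ ^ 2 := by positivity
      have h7 : 0 ≤ γ * (α * ∫ r in (0 : ℝ)..s, ‖v r‖ ^ 2) := by positivity
      have h8 : 0 ≤ γ * ‖u s‖ ^ 2 := by positivity
      simp only [hκ, hβ]
      nlinarith
    rw [intervalIntegral.integral_add i1 (c2.intervalIntegrable _ _),
      ← h1, intervalIntegral.integral_const_mul, intervalIntegral.integral_sub
        (c6.intervalIntegrable _ _) intervalIntegrable_const,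
      intervalIntegral.integral_const_mul, intervalIntegral.integral_const, smul_eq_mul] at h2
    have h3 : ∫ s in (0 : ℝ)..t, ⟪v s, j (u s)⟫ = ∫ s in (0 : ℝ)..t, ⟪a s, b s⟫ := by
      refine intervalIntegral.integral_congr fun r hr => ?_
      rw [uIcc_of_le ht.1] at hr
      simp only [hbv r hr.1, haj r hr.1, real_inner_comm]
    rw [h3, ← hbv t ht.1, ← haj t ht.1, ← hbv 0 le_rfl, ← haj 0 le_rfl, real_inner_comm,
      real_inner_comm (a 0)] at h2
    simp only [hD, intervalIntegral.integral_same, mul_zero, add_zero]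
    linarith
  · simp only [hD, intervalIntegral.integral_same, mul_zero, add_zero, zero_add]
    linarith
  · simp only [hG, hD, intervalIntegral.integral_same, mul_zero, add_zero, zero_add,
      hya 0 le_rfl, sub_zero]
    have h1 := mul_le_mul_of_nonneg_right hτ2 hT0.le
    have h2 : ‖a 0‖ ^ 2 = y0 := rfl
    rw [h2]
    calc y0 + 2 * α * y0 * T + β * τ ^ 2 = (2 * α * y0 + 1) * T := by rw [hT]; ring
      _ ≤ _ := h1

end IsWeakDampedWave

/-! ### The primitive of the nonlinearity. -/

section Primitive

variable {f : ℝ → ℝ}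

lemma hasDerivAt_primitive (hf : Continuous f) (y : ℝ) : HasDerivAt (primitive f) (f y) y :=
  (hf.integral_hasStrictDerivAt 0 y).hasDerivAt

lemma continuous_primitive (hf : Continuous f) : Continuous (primitive f) :=
  continuous_iff_continuousAt.2 fun y => (hasDerivAt_primitive hf y).continuousAt

@[simp] lemma primitive_zero (f : ℝ → ℝ) : primitive f 0 = 0 := by simp [primitive]

lemma primitive_sub (hf : Continuous f) (a b : ℝ) :
    primitive f b - primitive f a = ∫ s in a..b, f s :=
  intervalIntegral.integral_interval_sub_left (hf.intervalIntegrable _ _)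
    (hf.intervalIntegrable _ _)

lemma primitive_neg (hodd : ∀ y, f (-y) = - f y) (y : ℝ) : primitive f (-y) = primitive f y := by
  have h : ∫ s in (0 : ℝ)..y, f (-s) = ∫ s in -y..-0, f s := intervalIntegral.integral_comp_neg f
  simp only [hodd, intervalIntegral.integral_neg, neg_zero] at h
  have h' := intervalIntegral.integral_symm (f := f) (μ := volume) 0 (-y)
  simp only [primitive]
  linarith

lemma primitive_abs (hodd : ∀ y, f (-y) = - f y) (y : ℝ) : primitive f |y| = primitive f y := by
  rcases abs_choice y with h | h <;> rw [h]
  exact primitive_neg hodd y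

lemma apply_zero_of_odd (hodd : ∀ y, f (-y) = - f y) : f 0 = 0 := by
  have := hodd 0
  rw [neg_zero] at this
  linarith

end Primitive

/-! ### From the integrated to the pointwise Ambrosetti–Rabinowitz inequality. -/

section TestFunctions

variable {d : ℕ}

/-- The element of `H¹` given by a smooth function with compact support. -/
lemma exists_h1_of_contDiff {η : E d → ℝ} (hη : ContDiff ℝ ((⊤ : ℕ∞) : WithTop ℕ∞) η)
    (hc : HasCompactSupport η) : ∃ φ : H1 d, fn φ =ᵐ[volume] η := by
  have hL : MemLp η 2 (volume : Measure (E d)) := hη.continuous.memLp_of_hasCompactSupport hc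
  set G : E d → E d := fun x => (InnerProductSpace.toDual ℝ (E d)).symm (fderiv ℝ η x) with hG
  have hGe : ∀ x e, inner ℝ (G x) e = fderiv ℝ η x e := fun x e => by
    rw [hG, InnerProductSpace.toDual_symm_apply]
  have hGc : Continuous G :=
    (InnerProductSpace.toDual ℝ (E d)).symm.continuous.comp (hη.continuous_fderiv (by simp))
  have hGs : HasCompactSupport G := (hc.fderiv (𝕜 := ℝ)).comp_left (by simp)
  have hGL : MemLp G 2 (volume : Measure (E d)) := hGc.memLp_of_hasCompactSupport hGs
  refine ⟨⟨WithLp.toLp 2 (hL.toLp η, hGL.toLp G), ?_⟩, ?_⟩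
  · intro ψ hψ hψc e
    have h1 : ∫ x, (hL.toLp η : L2 d) x * fderiv ℝ ψ x e = ∫ x, η x * fderiv ℝ ψ x e :=
      integral_congr_ae (by filter_upwards [hL.coeFn_toLp] with x hx; rw [hx])
    have h2 : ∫ x, inner ℝ ((hGL.toLp G : L2Vec d) x) e * ψ x = ∫ x, fderiv ℝ η x e * ψ x :=
      integral_congr_ae (by filter_upwards [hGL.coeFn_toLp] with x hx; rw [hx, hGe])
    have hηd : Differentiable ℝ η := hη.differentiable (by simp)
    have hψd : Differentiable ℝ ψ := hψ.differentiable (by simp)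
    have hηe : Continuous fun x => fderiv ℝ η x e :=
      (hη.continuous_fderiv (by simp)).clm_apply continuous_const
    have hψe : Continuous fun x => fderiv ℝ ψ x e :=
      (hψ.continuous_fderiv (by simp)).clm_apply continuous_const
    refine (h1.trans ?_).trans (congrArg Neg.neg h2.symm)
    refine integral_mul_fderiv_eq_neg_fderiv_mul_of_integrable ?_ ?_ ?_
      (fun x _ => hηd x) (fun x _ => hψd x)
    · exact (hηe.mul hψ.continuous).integrable_of_hasCompactSupport hψc.mul_left
    · exact (hη.continuous.mul hψe).integrable_of_hasCompactSupport hc.mul_right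
    · exact (hη.continuous.mul hψ.continuous).integrable_of_hasCompactSupport hψc.mul_left
  · exact hL.coeFn_toLp

/-- A continuous `k` with `∫ k(φ) ≤ 0` for all `φ ∈ H¹` is nonpositive. -/
lemma nonpos_of_forall_integral_nonpos {k : ℝ → ℝ} (hk : Continuous k) (hk0 : k 0 = 0)
    (h : ∀ φ : H1 d, ∫ x, k (fn φ x) ≤ 0) (y : ℝ) : k y ≤ 0 := by
  have hpos : ∀ n : ℕ, (0 : ℝ) < 1 / ((n : ℝ) + 1) := fun n => Nat.one_div_pos_of_nat
  -- These bumps decrease to the indicator of the closed unit ball. Since `k 0 = 0`, the limit of `∫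
  -- k(y χ)` is `k y` times the volume of the ball.
  let χ : ℕ → ContDiffBump (0 : E d) := fun n =>
    ⟨1, 1 + 1 / ((n : ℝ) + 1), one_pos, by linarith [hpos n]⟩
  have hle : ∀ n, ∫ x, k (y * χ n x) ≤ 0 := by
    intro n
    obtain ⟨φ, hφ⟩ := exists_h1_of_contDiff (η := fun x => y * χ n x)
      (contDiff_const.mul (χ n).contDiff) ((χ n).hasCompactSupport.mul_left)
    refine le_of_eq_of_le (integral_congr_ae ?_) (h φ)
    filter_upwards [hφ] with x hx
    rw [hx]
  obtain ⟨K, hK⟩ := (isCompact_Icc (a := -|y|) (b := |y|)).exists_bound_of_continuousOn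
    hk.continuousOn
  have hlim : Tendsto (fun n => ∫ x, k (y * χ n x)) atTop
      (𝓝 (∫ x, (Metric.closedBall (0 : E d) 1).indicator (fun _ => k y) x)) := by
    refine tendsto_integral_of_dominated_convergence
      ((Metric.closedBall (0 : E d) 2).indicator fun _ => K) (fun n => ?_) ?_ (fun n => ?_) ?_
    · exact (hk.comp (continuous_const.mul (χ n).continuous)).aestronglyMeasurable
    · rw [integrable_indicator_iff measurableSet_closedBall]
      exact integrableOn_const (isCompact_closedBall _ _).measure_ne_top
    · refine Eventually.of_forall fun x => ?_
      by_cases hx : x ∈ Metric.closedBall (0 : E d) 2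
      · rw [indicator_of_mem hx]
        refine hK _ (abs_le.1 ?_)
        rw [abs_mul, abs_of_nonneg (χ n).nonneg]
        exact mul_le_of_le_one_right (abs_nonneg _) (χ n).le_one
      · rw [indicator_of_notMem hx, (χ n).zero_of_le_dist, mul_zero, hk0, norm_zero]
        rw [Metric.mem_closedBall, not_le] at hx
        have : 1 / ((n : ℝ) + 1) ≤ 1 := by
          rw [div_le_one (by positivity)]
          linarith [(Nat.cast_nonneg n : (0 : ℝ) ≤ n)]
        change 1 + 1 / ((n : ℝ) + 1) ≤ dist x 0
        linarith
    · refine Eventually.of_forall fun x => ?_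
      by_cases hx : x ∈ Metric.closedBall (0 : E d) 1
      · rw [indicator_of_mem hx]
        refine tendsto_const_nhds.congr fun n => ?_
        rw [(χ n).one_of_mem_closedBall hx, mul_one]
      · rw [indicator_of_notMem hx]
        rw [Metric.mem_closedBall, not_le] at hx
        have h1 : ∀ᶠ n : ℕ in atTop, 1 / ((n : ℝ) + 1) < dist x 0 - 1 :=
          tendsto_one_div_add_atTop_nhds_zero_nat.eventually_lt_const (by linarith)
        refine tendsto_const_nhds.congr' ?_
        filter_upwards [h1] with n hn
        rw [(χ n).zero_of_le_dist, mul_zero, hk0]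
        change 1 + 1 / ((n : ℝ) + 1) ≤ dist x 0
        linarith
  have h2 := le_of_tendsto' hlim hle
  rw [integral_indicator measurableSet_closedBall, setIntegral_const, smul_eq_mul] at h2
  have h3 : 0 < (volume : Measure (E d)).real (Metric.closedBall 0 1) :=
    ENNReal.toReal_pos (Metric.measure_closedBall_pos _ _ one_pos).ne'
      (isCompact_closedBall _ _).measure_ne_top
  exact nonpos_of_mul_nonpos_right h2 h3

/-- The Ambrosetti–Rabinowitz condition holds pointwise. -/
lemma AmbrosettiRabinowitz.pointwise {f : ℝ → ℝ} (hf : Continuous f)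
    (h : AmbrosettiRabinowitz d f) :
    ∃ γ : ℝ, 0 < γ ∧ ∀ y, 2 * (1 + γ) * primitive f y ≤ y * f y := by
  obtain ⟨γ, hγ, h⟩ := h
  refine ⟨γ, hγ, fun y => ?_⟩
  have := nonpos_of_forall_integral_nonpos
    (k := fun y => 2 * (1 + γ) * primitive f y - y * f y)
    ((continuous_const.mul (continuous_primitive hf)).sub (continuous_id.mul hf)) (by simp) h y
  linarith

end TestFunctions

/-! ### Sign and truncation of the nonlinearity. -/

section Nonlinearity

variable {f : ℝ → ℝ} {p y₁ : ℝ}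

/-- Beyond a point where `F` is positive, `F` and `f` stay nonnegative. -/
lemma primitive_nonneg_of_le (hf : Continuous f)
    (hAR : ∀ y, p * primitive f y ≤ y * f y) (hy₁ : 0 < y₁) (hF : 0 < primitive f y₁) {y : ℝ}
    (hy : y₁ ≤ y) : 0 ≤ primitive f y := by
  have hpos : ∀ x ∈ Ici y₁, 0 < x := fun x hx => hy₁.trans_le hx
  have hder : ∀ x ∈ Ici y₁, HasDerivAt (fun x => primitive f x * x ^ (-p))
      (f x * x ^ (-p) + primitive f x * (-p * x ^ (-p - 1))) x := fun x hx =>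
    (hasDerivAt_primitive hf x).mul (Real.hasDerivAt_rpow_const (Or.inl (hpos x hx).ne'))
  -- The derivative is `x^{-p-1} (x f(x) - p F(x))`, nonnegative by `hAR`.
  have hmono : MonotoneOn (fun x => primitive f x * x ^ (-p)) (Ici y₁) := by
    refine monotoneOn_of_deriv_nonneg (convex_Ici y₁)
      (fun x hx => (hder x hx).continuousAt.continuousWithinAt)
      (fun x hx => (hder x (interior_subset hx)).differentiableAt.differentiableWithinAt)
      fun x hx => ?_
    have hx' := hpos x (interior_subset hx)
    rw [(hder x (interior_subset hx)).deriv]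
    have h1 : x ^ (-p) = x * x ^ (-p - 1) := by
      rw [Real.rpow_sub_one hx'.ne']
      field_simp
    have h2 : 0 < x ^ (-p - 1) := Real.rpow_pos_of_pos hx' _
    rw [h1]
    nlinarith [mul_le_mul_of_nonneg_right (hAR x) h2.le]
  have h1 := hmono self_mem_Ici hy hy
  have h2 : 0 < y₁ ^ (-p) := Real.rpow_pos_of_pos hy₁ _
  have h3 : 0 < y ^ (-p) := Real.rpow_pos_of_pos (hpos y hy) _
  have h4 : 0 < primitive f y * y ^ (-p) := (mul_pos hF h2).trans_le h1
  exact (pos_of_mul_pos_left h4 h3.le).le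

lemma nonneg_of_le (hp : 0 ≤ p) (hf : Continuous f)
    (hAR : ∀ y, p * primitive f y ≤ y * f y) (hy₁ : 0 < y₁) (hF : 0 < primitive f y₁) {y : ℝ}
    (hy : y₁ ≤ y) : 0 ≤ f y := by
  have h1 := mul_nonneg hp (primitive_nonneg_of_le hf hAR hy₁ hF hy)
  exact nonneg_of_mul_nonneg_right (h1.trans (hAR y)) (hy₁.trans_le hy)

/-- A `C¹` function vanishing at the origin has a primitive with a quadratic bound near `0`. -/
lemma exists_primitive_abs_le (hf : ContDiff ℝ 1 f) (hf0 : f 0 = 0) (R : ℝ) :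
    ∃ C, 0 ≤ C ∧ ∀ y, |y| ≤ R → |primitive f y| ≤ C * y ^ 2 := by
  obtain ⟨C, hC⟩ := (isCompact_Icc (a := -R) (b := R)).exists_bound_of_continuousOn
    (hf.continuous_deriv le_rfl).continuousOn
  refine ⟨max C 0, le_max_right _ _, fun y hy => ?_⟩
  have hmem : ∀ s, |s| ≤ |y| → s ∈ Icc (-R) R := fun s hs => abs_le.1 (hs.trans hy)
  have h1 : ∀ s, |s| ≤ |y| → |f s| ≤ max C 0 * |y| := by
    intro s hs
    have h2 := (convex_Icc (-R) R).norm_image_sub_le_of_norm_deriv_le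
      (fun x _ => (hf.differentiable one_ne_zero) x)
      (fun x hx => (hC x hx).trans (le_max_left C 0)) (hmem 0 (by simp)) (hmem s hs)
    rw [hf0, sub_zero, sub_zero, Real.norm_eq_abs, Real.norm_eq_abs] at h2
    exact h2.trans (mul_le_mul_of_nonneg_left hs (le_max_right _ _))
  have h3 : ‖∫ s in (0 : ℝ)..y, f s‖ ≤ (max C 0 * |y|) * |y - 0| := by
    refine intervalIntegral.norm_integral_le_of_norm_le_const fun s hs => h1 s ?_
    have := abs_sub_left_of_mem_uIcc (uIoc_subset_uIcc hs)
    simpa using this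
  rw [sub_zero, mul_assoc, ← pow_two, sq_abs] at h3
  exact h3

/-- A smooth cutoff function, equal to `1` on `[-n-1, n+1]` and supported in `[-n-2, n+2]`. -/
def cutoff (n : ℕ) : ContDiffBump (0 : ℝ) := ⟨n + 1, n + 2, by positivity, by linarith⟩

/-- The truncated nonlinearity. -/
def truncate (f : ℝ → ℝ) (n : ℕ) (y : ℝ) : ℝ := f y * cutoff n y

lemma continuous_truncate (hf : Continuous f) (n : ℕ) : Continuous (truncate f n) :=
  hf.mul (cutoff n).continuous

lemma truncate_eq {n : ℕ} {y : ℝ} (hy : |y| ≤ n + 1) : truncate f n y = f y := by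
  rw [truncate, (cutoff n).one_of_mem_closedBall, mul_one]
  simpa [cutoff] using hy

lemma abs_truncate_le (n : ℕ) (y : ℝ) : |truncate f n y| ≤ |f y| := by
  rw [truncate, abs_mul, abs_of_nonneg (cutoff n).nonneg]
  exact mul_le_of_le_one_right (abs_nonneg _) (cutoff n).le_one

lemma truncate_odd (hodd : ∀ y, f (-y) = - f y) (n : ℕ) (y : ℝ) :
    truncate f n (-y) = - truncate f n y := by
  rw [truncate, truncate, hodd, (cutoff n).neg, neg_mul]

/-- A Lipschitz function vanishing at `0` acts on L², and its potential is differentiable there. -/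
lemma exists_lipschitzWith_truncate (hf : ContDiff ℝ 1 f) (n : ℕ) :
    ∃ C, LipschitzWith C (truncate f n) :=
  ContDiff.lipschitzWith_of_hasCompactSupport (n := 1) (𝕂 := ℝ)
    ((cutoff n).hasCompactSupport.mul_left)
    (hf.mul (cutoff n).contDiff) one_ne_zero

lemma primitive_truncate_eq {n : ℕ} {y : ℝ} (hy : |y| ≤ n + 1) :
    primitive (truncate f n) y = primitive f y := by
  refine intervalIntegral.integral_congr fun s hs => truncate_eq ?_
  have := abs_sub_left_of_mem_uIcc hs
  simp only [sub_zero] at this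
  exact this.trans hy

lemma tendsto_truncate (f : ℝ → ℝ) (y : ℝ) :
    Tendsto (fun n => truncate f n y) atTop (𝓝 (f y)) := by
  refine tendsto_const_nhds.congr' ?_
  filter_upwards [eventually_ge_atTop ⌈|y|⌉₊] with n hn
  refine (truncate_eq ?_).symm
  linarith [Nat.ceil_le.1 hn]

lemma tendsto_primitive_truncate (f : ℝ → ℝ) (y : ℝ) :
    Tendsto (fun n => primitive (truncate f n) y) atTop (𝓝 (primitive f y)) := by
  refine tendsto_const_nhds.congr' ?_
  filter_upwards [eventually_ge_atTop ⌈|y|⌉₊] with n hn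
  refine (primitive_truncate_eq ?_).symm
  linarith [Nat.ceil_le.1 hn]

/-- The truncated potentials are bounded by the potential and a quadratic term. -/
lemma abs_primitive_truncate_le (hf : ContDiff ℝ 1 f) (hodd : ∀ y, f (-y) = - f y) (hp : 0 ≤ p)
    (hAR : ∀ y, p * primitive f y ≤ y * f y) (hy₁ : 0 < y₁) (hF : 0 < primitive f y₁) :
    ∃ C, ∀ᶠ n in atTop, ∀ y,
      |primitive (truncate f n) y| ≤ |primitive f y| + C * y ^ 2 := by
  obtain ⟨C, hC0, hC⟩ := exists_primitive_abs_le hf (apply_zero_of_odd hodd) y₁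
  refine ⟨C, ?_⟩
  filter_upwards [eventually_ge_atTop ⌈y₁⌉₊] with n hn
  have hn' : y₁ ≤ n := Nat.ceil_le.1 hn
  intro y
  rcases le_total |y| y₁ with h | h
  · rw [primitive_truncate_eq (by linarith)]
    have : 0 ≤ C * y ^ 2 := by positivity
    linarith
  -- Both primitives are even, agree at `y₁`, and have integrands with `0 ≤ truncate f n ≤ f` beyond
  -- it.
  · rw [← primitive_abs (truncate_odd hodd n) y, ← primitive_abs hodd y]
    have h1 := primitive_sub hf.continuous y₁ |y|
    have h2 := primitive_sub (continuous_truncate hf.continuous n) y₁ |y|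
    have h3 : ∫ s in y₁..|y|, truncate f n s ≤ ∫ s in y₁..|y|, f s := by
      refine intervalIntegral.integral_mono_on h
        ((continuous_truncate hf.continuous n).intervalIntegrable _ _)
        (hf.continuous.intervalIntegrable _ _) fun s hs => ?_
      exact mul_le_of_le_one_right (nonneg_of_le hp hf.continuous hAR hy₁ hF hs.1) (cutoff n).le_one
    have h4 : 0 ≤ ∫ s in y₁..|y|, truncate f n s := by
      refine intervalIntegral.integral_nonneg h fun s hs => ?_
      exact mul_nonneg (nonneg_of_le hp hf.continuous hAR hy₁ hF hs.1) (cutoff n).nonneg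
    have h5 : primitive (truncate f n) y₁ = primitive f y₁ :=
      primitive_truncate_eq (by rw [abs_of_pos hy₁]; linarith)
    have h6 : 0 ≤ C * y ^ 2 := by positivity
    rw [h5] at h2
    rw [abs_of_nonneg (a := primitive (truncate f n) |y|) (by linarith),
      abs_of_nonneg (a := primitive f |y|) (by linarith)]
    linarith

/-- Bound of the potential by the quantities which are integrable along a solution. -/
lemma abs_primitive_le (hf : ContDiff ℝ 1 f) (hodd : ∀ y, f (-y) = - f y) (hp : 1 ≤ p)
    (hAR : ∀ y, p * primitive f y ≤ y * f y) (hy₁ : 0 < y₁) (hF : 0 < primitive f y₁) :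
    ∃ C, ∀ y, |primitive f y| ≤ |y * f y| + C * y ^ 2 := by
  obtain ⟨C, hC0, hC⟩ := exists_primitive_abs_le hf (apply_zero_of_odd hodd) y₁
  refine ⟨C, fun y => ?_⟩
  have h0 : 0 ≤ C * y ^ 2 := by positivity
  rcases le_total |y| y₁ with h | h
  · linarith [hC y h, abs_nonneg (y * f y)]
  · have h1 := primitive_nonneg_of_le hf.continuous hAR hy₁ hF h
    rw [primitive_abs hodd] at h1
    rw [abs_of_nonneg h1]
    have h2 := hAR y
    nlinarith [le_abs_self (y * f y)]

end Nonlinearity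

/-! ### The potential energy along a curve in L². -/

section Potential

variable {d : ℕ}

lemma integrable_sq (a : L2 d) : Integrable fun x => (a x) ^ 2 :=
  (Lp.memLp a).integrable_sq

lemma integral_sq (a : L2 d) : ∫ x, (a x) ^ 2 = ‖a‖ ^ 2 := by
  rw [← real_inner_self_eq_norm_sq, L2.inner_def]
  refine integral_congr_ae (Eventually.of_forall fun x => ?_)
  simp [pow_two]

lemma integral_norm_sq (a : L2Vec d) : ∫ x, ‖a x‖ ^ 2 = ‖a‖ ^ 2 := by
  rw [← real_inner_self_eq_norm_sq, L2.inner_def]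
  refine integral_congr_ae (Eventually.of_forall fun x => ?_)
  simp

lemma integrable_norm_sq (a : L2Vec d) : Integrable fun x => ‖a x‖ ^ 2 :=
  (Lp.memLp a).norm.integrable_sq

lemma inner_eq_integral_mul (a b : L2 d) : ⟪a, b⟫ = ∫ x, a x * b x := by
  rw [L2.inner_def]
  refine integral_congr_ae (Eventually.of_forall fun x => ?_)
  simp [mul_comm]

lemma integrable_mul (a b : L2 d) : Integrable fun x => a x * b x :=
  (Lp.memLp a).integrable_mul (Lp.memLp b)

lemma aestronglyMeasurable_primitive {k : ℝ → ℝ} (hk : Continuous k) (a : L2 d) :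
    AEStronglyMeasurable (fun x => primitive k (a x)) volume :=
  (continuous_primitive hk).comp_aestronglyMeasurable (Lp.aestronglyMeasurable a)

variable {k : ℝ → ℝ} {C : ℝ≥0}

/-- The remainder is `∫ₐᵇ (k(s) - k(a)) ds`. -/
lemma abs_primitive_taylor_le (hk : LipschitzWith C k) (a b : ℝ) :
    |primitive k b - primitive k a - k a * (b - a)| ≤ C * (b - a) ^ 2 := by
  have h1 : primitive k b - primitive k a - k a * (b - a) = ∫ s in a..b, (k s - k a) := by
    rw [primitive_sub hk.continuous, intervalIntegral.integral_sub
      (hk.continuous.intervalIntegrable _ _) intervalIntegrable_const,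
      intervalIntegral.integral_const, smul_eq_mul, mul_comm (k a)]
  have h2 : ‖∫ s in a..b, (k s - k a)‖ ≤ (C * |b - a|) * |b - a| := by
    refine intervalIntegral.norm_integral_le_of_norm_le_const fun s hs => ?_
    have h3 := hk.dist_le_mul s a
    rw [Real.dist_eq, Real.dist_eq] at h3
    exact h3.trans (mul_le_mul_of_nonneg_left
      (abs_sub_left_of_mem_uIcc (uIoc_subset_uIcc hs)) C.2)
  rw [h1]
  rw [mul_assoc, ← pow_two, sq_abs] at h2
  exact h2

lemma integrable_primitive_of_lipschitz (hk : LipschitzWith C k) (hk0 : k 0 = 0) (a : L2 d) :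
    Integrable fun x => primitive k (a x) := by
  refine ((integrable_sq a).const_mul (C : ℝ)).mono'
    (aestronglyMeasurable_primitive hk.continuous a) (Eventually.of_forall fun x => ?_)
  simpa [hk0] using abs_primitive_taylor_le hk 0 (a x)

/-- The functional `φ ↦ ∫ K(φ)` on `L²` is differentiable if `K' = k` is Lipschitz. -/
lemma hasFDerivAt_integral_primitive (hk : LipschitzWith C k) (hk0 : k 0 = 0) (a : L2 d) :
    HasFDerivAt (fun b : L2 d => ∫ x, primitive k (b x)) (innerSL ℝ (hk.compLp hk0 a)) a := by
  have hbound : ∀ b : L2 d, ‖(∫ x, primitive k (b x)) - (∫ x, primitive k (a x))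
      - innerSL ℝ (hk.compLp hk0 a) (b - a)‖ ≤ C * ‖b - a‖ ^ 2 := by
    intro b
    have hib := integrable_primitive_of_lipschitz hk hk0 b
    have hia := integrable_primitive_of_lipschitz hk hk0 a
    have hiba : Integrable fun x => primitive k (b x) - primitive k (a x) := hib.sub hia
    rw [innerSL_apply_apply, inner_eq_integral_mul, ← integral_sub hib hia,
      ← integral_sub hiba (integrable_mul _ _), ← integral_sq, ← integral_const_mul]
    refine norm_integral_le_of_norm_le ((integrable_sq (b - a)).const_mul _) ?_
    filter_upwards [Lp.coeFn_sub b a, hk.coeFn_compLp hk0 a] with x h1 h2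
    rw [h1, h2]
    exact abs_primitive_taylor_le hk (a x) (b x)
  have h1 : HasFDerivAt (fun b : L2 d => (∫ x, primitive k (b x)) - (∫ x, primitive k (a x))
      - innerSL ℝ (hk.compLp hk0 a) (b - a)) (0 : L2 d →L[ℝ] ℝ) a := by
    refine Asymptotics.IsBigO.hasFDerivAt (n := 2) ?_ one_lt_two
    refine Asymptotics.IsBigO.of_bound C (Eventually.of_forall fun b => ?_)
    rw [norm_pow, norm_norm]
    exact hbound b
  have h2 : HasFDerivAt (fun b : L2 d => innerSL ℝ (hk.compLp hk0 a) (b - a))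
      (innerSL ℝ (hk.compLp hk0 a)) a := by
    simp only [map_sub]
    exact (innerSL ℝ (hk.compLp hk0 a)).hasFDerivAt.sub_const _
  have h3 := (h1.add h2).add_const (∫ x, primitive k (a x))
  rw [zero_add] at h3
  refine h3.congr_of_eventuallyEq (Eventually.of_forall fun b => ?_)
  simp

variable {w v : ℝ → L2 d}

/-- The chain rule for `∫ K(w(t))`. -/
lemma integral_primitive_comp (hk : LipschitzWith C k) (hk0 : k 0 = 0) (hw : Continuous w)
    (hv : Continuous v) (hd : ∀ t, 0 ≤ t → HasDerivWithinAt w (v t) (Ici t) t) {t : ℝ}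
    (ht : 0 ≤ t) :
    (∫ x, primitive k (w t x)) - ∫ x, primitive k (w 0 x) =
      ∫ s in (0 : ℝ)..t, ⟪hk.compLp hk0 (w s), v s⟫ := by
  refine (intervalIntegral.integral_eq_sub_of_hasDeriv_right_of_le
    (f := fun s => ∫ x, primitive k (w s x)) ht ?_ (fun s hs => ?_) ?_).symm
  · refine Continuous.continuousOn ?_
    exact (continuous_iff_continuousAt.2 fun a =>
      (hasFDerivAt_integral_primitive hk hk0 a).continuousAt).comp hw
  · exact (hasFDerivAt_integral_primitive hk hk0 (w s)).comp_hasDerivWithinAt s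
      ((hd s hs.1.le).mono Ioi_subset_Ici_self)
  · exact (((hk.continuous_compLp hk0).comp hw).inner hv).intervalIntegrable _ _

/-- The evolution of the potential energy along a curve `w ∈ C¹([0, ∞), L²)` with
`f(w) ∈ L¹_loc([0, ∞), L²)`. -/
theorem integral_primitive_evolution {f : ℝ → ℝ} {p y₁ : ℝ} {g : ℝ → L2 d}
    (hf : ContDiff ℝ 1 f) (hodd : ∀ y, f (-y) = - f y) (hp : 1 ≤ p)
    (hAR : ∀ y, p * primitive f y ≤ y * f y) (hy₁ : 0 < y₁) (hF : 0 < primitive f y₁)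
    (hw : Continuous w) (hv : Continuous v)
    (hd : ∀ t, 0 ≤ t → HasDerivWithinAt w (v t) (Ici t) t)
    (hg : ∀ t, 0 ≤ t → IntervalIntegrable g volume 0 t)
    (hgf : ∀ᵐ s : ℝ, 0 ≤ s → g s =ᵐ[volume] fun x => f (w s x))
    (h0 : Integrable fun x => primitive f (w 0 x)) :
    ∀ᵐ t : ℝ, 0 ≤ t → Integrable (fun x => primitive f (w t x)) ∧
      ∫ x, primitive f (w t x) = (∫ x, primitive f (w 0 x)) + ∫ s in (0 : ℝ)..t, ⟪g s, v s⟫ := by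
  have hf0 := apply_zero_of_odd hodd
  have ht0 : ∀ n, truncate f n 0 = 0 := fun n => by simp [truncate, hf0]
  choose C hC using exists_lipschitzWith_truncate hf
  obtain ⟨A, hA⟩ := abs_primitive_truncate_le hf hodd (by linarith) hAR hy₁ hF
  obtain ⟨B, hB⟩ := abs_primitive_le hf hodd hp hAR hy₁ hF
  have hlimF : ∀ a : L2 d, Integrable (fun x => primitive f (a x)) →
      Tendsto (fun n => ∫ x, primitive (truncate f n) (a x)) atTop
        (𝓝 (∫ x, primitive f (a x))) := by
    intro a ha
    refine tendsto_integral_filter_of_dominated_convergence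
      (fun x => |primitive f (a x)| + A * (a x) ^ 2) ?_ ?_
      (ha.abs.add ((integrable_sq a).const_mul A)) ?_
    · exact Eventually.of_forall fun n =>
        aestronglyMeasurable_primitive (continuous_truncate hf.continuous n) a
    · filter_upwards [hA] with n hn
      exact Eventually.of_forall fun x => hn (a x)
    · exact Eventually.of_forall fun x => tendsto_primitive_truncate f (a x)
  -- Only almost every `t` is reached: integrability of `F(w t)` uses `f(w t) = g t ∈ L²`, through
  -- `|F(y)| ≤ |y f(y)| + B y²`.
  filter_upwards [hgf] with t hgt ht
  have hFt : Integrable fun x => primitive f (w t x) := by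
    refine ((integrable_mul (w t) (g t)).abs.add ((integrable_sq (w t)).const_mul B)).mono'
      (aestronglyMeasurable_primitive hf.continuous (w t)) ?_
    filter_upwards [hgt ht] with x hx
    simp only [Pi.add_apply, hx]
    exact hB (w t x)
  refine ⟨hFt, ?_⟩
  obtain ⟨M, hM⟩ := (isCompact_Icc (a := (0 : ℝ)) (b := t)).exists_bound_of_continuousOn
    hv.continuousOn
  have hlimI : Tendsto (fun n => ∫ s in (0 : ℝ)..t, ⟪(hC n).compLp (ht0 n) (w s), v s⟫) atTop
      (𝓝 (∫ s in (0 : ℝ)..t, ⟪g s, v s⟫)) := by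
    refine intervalIntegral.tendsto_integral_filter_of_dominated_convergence
      (fun s => ‖g s‖ * M) ?_ ?_ ((hg t ht).norm.mul_const M) ?_
    · exact Eventually.of_forall fun n =>
        ((((hC n).continuous_compLp (ht0 n)).comp hw).inner hv).aestronglyMeasurable
    · refine Eventually.of_forall fun n => ?_
      filter_upwards [hgf] with s hs hst
      rw [uIoc_of_le ht] at hst
      refine (norm_inner_le_norm _ _).trans ?_
      refine mul_le_mul ?_ (hM s ⟨hst.1.le, hst.2⟩) (norm_nonneg _) (norm_nonneg _)
      refine Lp.norm_le_norm_of_ae_le ?_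
      filter_upwards [hs hst.1.le, (hC n).coeFn_compLp (ht0 n) (w s)] with x h1 h2
      rw [h1, h2]
      exact abs_truncate_le n (w s x)
    -- For fixed `s`, a second dominated convergence, in space, with majorant `|g v|`.
    · filter_upwards [hgf] with s hs hst
      rw [uIoc_of_le ht] at hst
      simp only [inner_eq_integral_mul]
      refine tendsto_integral_of_dominated_convergence (fun x => |g s x * v s x|) (fun n => ?_)
        (integrable_mul (g s) (v s)).abs (fun n => ?_) ?_
      · exact (integrable_mul _ _).aestronglyMeasurable
      · filter_upwards [hs hst.1.le, (hC n).coeFn_compLp (ht0 n) (w s)] with x h1 h2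
        rw [h1, h2, Real.norm_eq_abs, abs_mul, abs_mul]
        exact mul_le_mul_of_nonneg_right (abs_truncate_le n (w s x)) (abs_nonneg _)
      · have h3 : ∀ᵐ x : E d, ∀ n, ((hC n).compLp (ht0 n) (w s) : L2 d) x
            = truncate f n (w s x) := ae_all_iff.2 fun n => (hC n).coeFn_compLp (ht0 n) (w s)
        filter_upwards [hs hst.1.le, h3] with x h1 h2
        simp only [h1, h2]
        exact (tendsto_truncate f (w s x)).mul_const _
  have h1 := (hlimF (w t) hFt).sub (hlimF (w 0) h0)
  have h2 := tendsto_nhds_unique h1 (hlimI.congr fun n =>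
    (integral_primitive_comp (hC n) (ht0 n) hw hv hd ht).symm)
  linarith

end Potential

lemma intervalIntegral_inner_const {B : Type*} [NormedAddCommGroup B] [InnerProductSpace ℝ B]
    [CompleteSpace B] {c : ℝ → B} {a b : ℝ} (hc : IntervalIntegrable c volume a b) (w : B) :
    ∫ s in a..b, ⟪c s, w⟫ = ⟪∫ s in a..b, c s, w⟫ := by
  simp only [real_inner_comm w]
  exact (innerSL ℝ w).intervalIntegral_comp_comm hc

lemma timeInterval_top : timeInterval ⊤ = Ici 0 := by
  ext t
  simp [timeInterval, EReal.coe_lt_top]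

/-! ### The energy, and the passage to the abstract equation. -/

section Energy

variable {d : ℕ} {f : ℝ → ℝ} {φ : H1 d} {ψ : L2 d}

lemma norm_sq_h1 (φ : H1 d) :
    ‖(φ : WithLp 2 (L2 d × L2Vec d))‖ ^ 2 = ‖fn φ‖ ^ 2 + ‖grad φ‖ ^ 2 :=
  WithLp.prod_norm_sq_eq_of_L2 _

lemma integrable_quadratic (φ : H1 d) (ψ : L2 d) : Integrable fun x =>
    1 / 2 * ‖grad φ x‖ ^ 2 + 1 / 2 * (fn φ x) ^ 2 + 1 / 2 * (ψ x) ^ 2 :=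
  (((integrable_norm_sq _).const_mul _).add ((integrable_sq _).const_mul _)).add
    ((integrable_sq _).const_mul _)

/-- A nonvanishing energy forces the potential energy to be finite. -/
lemma integrable_primitive_of_energy_ne_zero (h : energy f φ ψ ≠ 0) :
    Integrable fun x => primitive f (fn φ x) := by
  have h1 : Integrable fun x => 1 / 2 * ‖grad φ x‖ ^ 2 + 1 / 2 * (fn φ x) ^ 2 + 1 / 2 * (ψ x) ^ 2
      - primitive f (fn φ x) := by
    -- The integral of a non-integrable function is `0` by convention, which the nonzero energy
    -- excludes.
    by_contra hn
    exact h (integral_undef hn)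
  refine ((integrable_quadratic φ ψ).sub h1).congr (Eventually.of_forall fun x => ?_)
  simp

lemma energy_eq (h : Integrable fun x => primitive f (fn φ x)) :
    energy f φ ψ = 1 / 2 * ‖(φ : WithLp 2 (L2 d × L2Vec d))‖ ^ 2 + 1 / 2 * ‖ψ‖ ^ 2
      - ∫ x, primitive f (fn φ x) := by
  have i1 : Integrable fun x => 1 / 2 * ‖grad φ x‖ ^ 2 := (integrable_norm_sq _).const_mul _
  have i2 : Integrable fun x => 1 / 2 * (fn φ x) ^ 2 := (integrable_sq _).const_mul _
  have i3 : Integrable fun x => 1 / 2 * (ψ x) ^ 2 := (integrable_sq _).const_mul _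
  have i4 : Integrable fun x => 1 / 2 * ‖grad φ x‖ ^ 2 + 1 / 2 * (fn φ x) ^ 2 := i1.add i2
  rw [energy, integral_sub (integrable_quadratic φ ψ) h, integral_add i4 i3, integral_add i1 i2,
    integral_const_mul, integral_const_mul, integral_const_mul, integral_sq, integral_sq,
    integral_norm_sq, norm_sq_h1]
  ring

/-- If the energy is negative, then the potential `F` is positive somewhere. -/
lemma exists_primitive_pos_of_energy_neg (hodd : ∀ y, f (-y) = - f y) (h : energy f φ ψ < 0) :
    ∃ y, 0 < y ∧ 0 < primitive f y := by
  have h1 := energy_eq (ψ := ψ) (integrable_primitive_of_energy_ne_zero h.ne)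
  by_contra! hn
  have h2 : ∀ y, primitive f y ≤ 0 := by
    intro y
    rcases eq_or_ne y 0 with rfl | hy
    · simp
    · rw [← primitive_abs hodd]
      exact hn _ (abs_pos.2 hy)
  have h3 : ∫ x, primitive f (fn φ x) ≤ 0 := integral_nonpos fun x => h2 _
  have h4 : 0 ≤ 1 / 2 * ‖(φ : WithLp 2 (L2 d × L2Vec d))‖ ^ 2 := by positivity
  have h5 : 0 ≤ 1 / 2 * ‖ψ‖ ^ 2 := by positivity
  linarith

end Energy

/-- A global strong solution is a weak solution of the linear damped wave equation with source
`f(u)`. -/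
lemma IsSolution.exists_isWeakDampedWave {d : ℕ} {α : ℝ} {f : ℝ → ℝ} {φ₀ : H1 d} {φ₁ : L2 d}
    {u : ℝ → H1 d} {v : ℝ → L2 d} (hu : IsSolution α f φ₀ φ₁ ⊤ u v) :
    ∃ g : ℝ → L2 d, (∀ᵐ s : ℝ, 0 ≤ s → g s =ᵐ[volume] fun x => f (fn (u s) x)) ∧
      IsWeakDampedWave (H1 d) (WithLp.fstL 2 ℝ (L2 d) (L2Vec d)) α
        (fun t => (u (max t 0) : WithLp 2 (L2 d × L2Vec d))) (fun t => v (max t 0)) g := by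
  obtain ⟨g, hgf, heq⟩ := hu.equation
  have hc1 := hu.continuousOn_fst
  have hc2 := hu.continuousOn_snd
  have hd := hu.hasDeriv
  simp only [timeInterval_top, mem_Ici] at hgf heq hc1 hc2 hd
  -- Freezing the solution at negative times makes it continuous on all of `ℝ`.
  have hmax : Continuous fun t : ℝ => max t 0 := continuous_id.max continuous_const
  have hmax0 : ∀ t : ℝ, max t 0 ∈ Ici (0 : ℝ) := fun t => mem_Ici.2 (le_max_right _ _)
  have hcu : Continuous fun t => (u (max t 0) : WithLp 2 (L2 d × L2Vec d)) :=
    continuous_subtype_val.comp (hc1.comp_continuous hmax hmax0)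
  refine ⟨g, hgf, ⟨hcu, hc2.comp_continuous hmax hmax0, fun t => (u _).2, fun t ht => ?_,
    fun t ht => (heq t ht).1, fun t ht w hw => ?_⟩⟩
  · simp only [max_eq_left ht]
    refine ((hd t ht).mono (Ici_subset_Ici.2 ht)).congr (fun s hs => ?_) ?_
    · rw [max_eq_left (ht.trans hs)]
      rfl
    · rw [max_eq_left ht]
      rfl
  · obtain ⟨hgi, h⟩ := heq t ht
    have h1 := h ⟨w, hw⟩
    rw [max_eq_left ht, max_self, hu.init_fst, hu.init_snd,
      ← intervalIntegral_inner_const (hcu.intervalIntegrable 0 t), ← intervalIntegral_inner_const hgi,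
      add_sub_assoc, ← intervalIntegral.integral_sub
        ((hcu.inner continuous_const).intervalIntegrable 0 t)
        (intervalIntegrable_inner hgi continuous_const)]
    refine Eq.trans ?_ h1
    congr 1
    refine intervalIntegral.integral_congr fun s hs => ?_
    rw [uIcc_of_le ht] at hs
    simp only [max_eq_left hs.1, WithLp.prod_inner_apply]
    rw [add_comm]
    rfl

end KleinGordon

end

/-! ### The blow-up theorem. -/

theorem corollary2p8 (d : ℕ) (hd1 : 1 ≤ d) (hd6 : d ≤ 6) (α : ℝ) (hα : 0 ≤ α)
    (f : ℝ → ℝ) (hf : ContDiff ℝ 1 f) (hodd : ∀ y, f (-y) = - f y) (hf0 : deriv f 0 = 0)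
    (hAR : KleinGordon.AmbrosettiRabinowitz d f)
    (hgrowth : 2 ≤ d → KleinGordon.SubcriticalGrowth d f)
    (φ₀ : KleinGordon.H1 d) (φ₁ : KleinGordon.L2 d)
    (hE : KleinGordon.energy f φ₀ φ₁ < 0)
    (T : EReal) (u : ℝ → KleinGordon.H1 d) (v : ℝ → KleinGordon.L2 d)
    (hu : KleinGordon.IsMaximalSolution α f φ₀ φ₁ T u v) :
    T < ⊤ := by
  open KleinGordon in
  by_contra hT
  obtain rfl : T = ⊤ := not_lt_top_iff.1 hT
  obtain ⟨γ, hγ, hARp⟩ := hAR.pointwise hf.continuous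
  obtain ⟨y₁, hy₁, hF⟩ := exists_primitive_pos_of_energy_neg hodd hE
  have hF0 := integrable_primitive_of_energy_ne_zero hE.ne
  have hE0 := energy_eq (ψ := φ₁) hF0
  obtain ⟨g, hgf, hw⟩ := hu.1.exists_isWeakDampedWave
  have hgf' : ∀ᵐ s : ℝ, 0 ≤ s → g s =ᵐ[volume] fun x => f (fn (u (max s 0)) x) := by
    filter_upwards [hgf] with s hs hs0
    rw [max_eq_left hs0]
    exact hs hs0
  have hev := integral_primitive_evolution (w := fun s => fn (u (max s 0))) hf hodd
    (by linarith) hARp hy₁ hF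
    ((WithLp.fstL 2 ℝ (L2 d) (L2Vec d)).continuous.comp hw.continuous_fst) hw.continuous_snd
    hw.hasDeriv hw.intervalIntegrable hgf' (by simpa [hu.1.init_fst] using hF0)
  -- It remains to bound `⟪f(u), u⟫` from below. The pointwise inequality bounds it by `2(1+γ) ∫
  -- F(u)`, and `hev` with the energy identity expresses `∫ F(u(t))` by norms, dissipation and
  -- initial energy.
  refine hw.blowup hα hγ hE ?_
  filter_upwards [hgf', hev] with t hgt hevt ht
  obtain ⟨hi, hevt⟩ := hevt ht
  have hen := hw.energy_identity ht
  simp only [max_self, hu.1.init_fst, hu.1.init_snd] at hevt hen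
  have hinner : inner ℝ (g t) (fn (u (max t 0))) =
      ∫ x, fn (u (max t 0)) x * f (fn (u (max t 0)) x) := by
    rw [inner_eq_integral_mul]
    refine integral_congr_ae ?_
    filter_upwards [hgt ht] with x hx
    rw [hx, mul_comm]
  have hint : Integrable fun x => fn (u (max t 0)) x * f (fn (u (max t 0)) x) := by
    refine (integrable_mul (fn (u (max t 0))) (g t)).congr ?_
    filter_upwards [hgt ht] with x hx
    rw [hx]
  have hle : 2 * (1 + γ) * ∫ x, primitive f (fn (u (max t 0)) x) ≤
      ∫ x, fn (u (max t 0)) x * f (fn (u (max t 0)) x) := by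
    rw [← integral_const_mul]
    exact integral_mono (hi.const_mul _) hint fun x => hARp _
  refine le_trans (le_of_eq ?_) (hle.trans_eq hinner.symm)
  congr 1
  rw [hevt, ← hen, hE0]
  ring
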